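/- **Setting.** Let $I$ be a finite index set (the observations of one block). For $t\in I$ let $m_t\ge 1$ and $0\le y_t\le m_t$ be integers (trials and successes), $w_t\ge 0$ a weight, $h_t>0$ the value of the base measure, and $\kappa_t=y_t-m_t/2$. The binomial-logistic likelihood is $$p(y\mid\theta)=\prod_{t\in I} h_t\Big(\frac{(e^\theta)^{y_t}}{(1+e^\theta)^{m_t}}\Big)^{w_t};$$ for $w_t=1$, $h_t=\binom{m_t}{y_t}$ the $t$-th factor is the probability of $y_t$ under $\mathrm{Binom}(m_t,(1+e^{-\theta})^{-1})$. The prior is $\pi=\mathcal N(\nu,\rho^2)$, $\rho>0$. For $b>0$, $c\in\mathbb R$, $\mathrm{PG}(b,c)$ is the law of $\frac1{2\pi^2}\sum_{k\ge1}\frac{g_k}{(k-1/2)^2+c^2/(4\pi^2)}$ with $g_k$ i.i.d. $\mathrm{Gamma}(b,1)$. The latent variables are independent $\omega_t\sim\mathrm{PG}(m_t,0)$, with joint law $P_0$, and the conditional (augmented) likelihood is $$p(y\mid\theta,\omega)=\prod_{t\in I} h_t\big(2^{-m_t}e^{\kappa_t\theta}e^{-\omega_t\theta^2/2}\big)^{w_t}.$$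 Put $A=\int p(y\mid\theta)\,\pi(d\theta)$ and $A^{\mathrm{aug}}=\iint p(y\mid\theta,\omega)\,P_0(d\omega)\,\pi(d\theta)$. For probability measures $q_\theta$ on $\mathbb R$ and $q_\omega$ on $\mathbb R^I$ put $$\mathcal L(q_\theta,q_\omega)=\mathbb E_{q_\theta\otimes q_\omega}[\log p(y\mid\theta,\omega)]-\mathrm{KL}(q_\theta\otimes q_\omega\,\|\,\pi\otimes P_0),$$ read as $-\infty$ if the divergence is infinite. **Theorem (conditional conjugacy via Pólya–Gamma).** 1. For every $t$, $\mathrm{PG}(m_t,0)$ is a probability law on $(0,\infty)$ with a Lebesgue density $p$, and for all $\theta\in\mathbb R$ $$\frac{(e^\theta)^{y_t}}{(1+e^\theta)^{m_t}}=2^{-m_t}e^{\kappa_t\theta}\int_0^\infty e^{-\omega\theta^2/2}\,p(\omega)\,d\omega .$$ 2. For all $\theta,\omega$: $\log p(y\mid\theta,\omega)=-\tfrac12\theta^2\sum_t w_t\omega_t+\theta\sum_t w_t\kappa_t+C$, where $C=\sum_t(\log h_t-w_tm_t\log2)$ depends neither on $\theta$ nor on $\omega$. 3. For every $\omega\in(0,\infty)^I$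 the conditional posterior, proportional to $p(y\mid\theta,\omega)\,\pi(d\theta)$, is $\mathcal N(\mu,\sigma^2)$ with $\sigma^{-2}=\rho^{-2}+\sum_t w_t\omega_t$ and $\mu=\sigma^2(\rho^{-2}\nu+\sum_t w_t\kappa_t)$. 4. $A^{\mathrm{aug}}>0$, with $A^{\mathrm{aug}}=A$ if all $w_t=1$ and $A^{\mathrm{aug}}\le A$ if all $w_t\le1$. The expectation in $\mathcal L(q_\theta,q_\omega)$ is finite whenever the divergence is, and $\mathcal L(q_\theta,q_\omega)\le\log A^{\mathrm{aug}}$ for all $q_\theta,q_\omega$. 5. If $\mathrm{KL}(q_\omega\|P_0)<\infty$, then all $\mathbb E_{q_\omega}[\omega_t]$ are finite, and the unique maximizer of $\mathcal L(\cdot,q_\omega)$ over all probability measures on $\mathbb R$ is $\mathcal N(\mu,\sigma^2)$ with $\sigma^{-2}=\rho^{-2}+\sum_t w_t\mathbb E_{q_\omega}[\omega_t]>0$ and $\mu=\sigma^2(\rho^{-2}\nu+\sum_tw_t\kappa_t)$. 6. If $\mathrm{KL}(q_\theta\|\pi)<\infty$, then $\mathbb E_{q_\theta}[\theta^2]$ is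 finite, and the unique maximizer of $\mathcal L(q_\theta,\cdot)$ over all probability measures on $\mathbb R^I$ is $\bigotimes_t\mathrm{PG}\big(m_t,\sqrt{w_t\,\mathbb E_{q_\theta}[\theta^2]}\big)$. 7. The moments used are in closed form: $\mathbb E[\theta^2]=\mu^2+s$ under $\mathcal N(\mu,s)$, and under $\bigotimes_t\mathrm{PG}(m_t,c_t)$ each $\omega_t$ is integrable with mean $e_t=\frac{m_t}{2c_t}\tanh\frac{c_t}2$ (and $e_t=m_t/4$ if $c_t=0$). So is the bound: for $s>0$, $$\mathcal L\Big(\mathcal N(\mu,s),\bigotimes_t\mathrm{PG}(m_t,c_t)\Big)=C+\mu\sum_tw_t\kappa_t-\frac{\mu^2+s}2\sum_tw_te_t-\frac12\Big(\log\frac{\rho^2}s+\frac{s+(\mu-\nu)^2}{\rho^2}-1\Big)-\sum_t\Big(m_t\log\cosh\frac{c_t}2-\frac{c_t^2}2e_t\Big).$$ -/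

import Mathlib

open MeasureTheory ProbabilityTheory Set
open scoped NNReal ENNReal

noncomputable section

namespace PolyaGamma

/-- The Pólya–Gamma law `PG(b, c)`: the law of
`(1 / (2 π²)) ∑_{k ≥ 1} g_k / ((k - 1/2)² + c² / (4 π²))`, where `g_1, g_2, …` are independent
`Gamma(b, 1)` variables (the index `k` below starts at `0`). -/
def pgMeasure (b c : ℝ) : Measure ℝ :=
  (Measure.infinitePi (fun _ : ℕ => gammaMeasure b 1)).map
    (fun g : ℕ → ℝ => (1 / (2 * Real.pi ^ 2)) *
      ∑' k : ℕ, g k / (((k : ℝ) + 1 / 2) ^ 2 + c ^ 2 / (4 * Real.pi ^ 2)))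

/-- The Lebesgue density of `PG(b, c)`. -/
def pgDensity (b c : ℝ) : ℝ → ℝ :=
  fun ω => ((pgMeasure b c).rnDeriv volume ω).toReal

/-- The closed form `(b / (2 c)) tanh (c / 2)` of the mean of `PG(b, c)`, extended by its limit
`b / 4` to `c = 0`. -/
def pgMean (b c : ℝ) : ℝ :=
  if c = 0 then b / 4 else b / (2 * c) * Real.tanh (c / 2)

end PolyaGamma

open PolyaGamma

/-- The data of a binomial-logistic block whose observations are indexed by `ι`: trial counts
`m t`, success counts `y t`, exposure weights `w t`, and values `h t` of the base measure at the
observations. -/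
structure LogisticBlock (ι : Type*) where
  m : ι → ℕ
  y : ι → ℕ
  w : ι → ℝ
  h : ι → ℝ
  m_pos : ∀ t, 0 < m t
  y_le : ∀ t, y t ≤ m t
  w_nonneg : ∀ t, 0 ≤ w t
  h_pos : ∀ t, 0 < h t

namespace LogisticBlock

variable {ι : Type*} (B : LogisticBlock ι)

/-- `κ_t = y_t - m_t / 2`. -/
def kappa (t : ι) : ℝ := (B.y t : ℝ) - (B.m t : ℝ) / 2

/-- The likelihood of one observation, `p(y_t ∣ θ) = h_t ((e^θ)^{y_t} / (1 + e^θ)^{m_t})^{w_t}`,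
that is, `log p(y_t ∣ θ) = w_t (y_t θ - m_t log (1 + e^θ)) + log h_t`. -/
def lik (t : ι) (θ : ℝ) : ℝ :=
  B.h t * (Real.exp θ ^ B.y t / (1 + Real.exp θ) ^ B.m t) ^ B.w t

/-- The likelihood of one observation given its Pólya–Gamma variable,
`p(y_t ∣ θ, ω_t) = h_t (2^{-m_t} e^{κ_t θ} e^{-ω_t θ² / 2})^{w_t}`. -/
def condLik (t : ι) (θ ω : ℝ) : ℝ :=
  B.h t * (((2 : ℝ) ^ B.m t)⁻¹ * Real.exp (B.kappa t * θ) *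
    Real.exp (-(ω * θ ^ 2 / 2))) ^ B.w t

variable [Fintype ι]

/-- The block likelihood `p(y ∣ θ)`. -/
def blockLik (θ : ℝ) : ℝ := ∏ t, B.lik t θ

/-- The conditional block likelihood `p(y ∣ θ, ω)`. -/
def blockCondLik (θ : ℝ) (ω : ι → ℝ) : ℝ := ∏ t, B.condLik t θ (ω t)

/-- The part of `log p(y ∣ θ, ω)` that depends neither on `θ` nor on `ω`. -/
def logConst : ℝ := ∑ t, (Real.log (B.h t) - B.w t * B.m t * Real.log 2)

/-- The law of independent `ω_t ∼ PG(m_t, c_t)`. -/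
def pgLaw (c : ι → ℝ) : Measure (ι → ℝ) :=
  Measure.pi (fun t => pgMeasure (B.m t) (c t))

/-- The prior of `(θ, ω)`: independent `θ ∼ N(ν, ρ²)` and `ω_t ∼ PG(m_t, 0)`. -/
def jointPrior (ν : ℝ) (ρ : ℝ≥0) : Measure (ℝ × (ι → ℝ)) :=
  (gaussianReal ν (ρ ^ 2)).prod (B.pgLaw 0)

/-- The block evidence `∫ p(y ∣ θ) π(θ) dθ`. -/
def evidence (ν : ℝ) (ρ : ℝ≥0) : ℝ :=
  ∫ θ, B.blockLik θ ∂(gaussianReal ν (ρ ^ 2))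

/-- The evidence of the augmented model, `∫∫ p(y ∣ θ, ω) p(ω) π(θ) dω dθ`. -/
def augEvidence (ν : ℝ) (ρ : ℝ≥0) : ℝ :=
  ∫ z, B.blockCondLik z.1 z.2 ∂(B.jointPrior ν ρ)

/-- The conditional posterior `p(θ ∣ y, ω) = p(y ∣ θ, ω) π(θ) / ∫ p(y ∣ θ', ω) π(θ') dθ'`. -/
def condPosterior (ν : ℝ) (ρ : ℝ≥0) (ω : ι → ℝ) : Measure ℝ :=
  (∫⁻ θ, ENNReal.ofReal (B.blockCondLik θ ω) ∂(gaussianReal ν (ρ ^ 2)))⁻¹ •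
    (gaussianReal ν (ρ ^ 2)).withDensity (fun θ => ENNReal.ofReal (B.blockCondLik θ ω))

/-- The variational objective (evidence lower bound) of the mean-field law `q(θ) q(ω)`,
`E_q [log p(y ∣ θ, ω)] - KL(q(θ) q(ω) ‖ π(θ) p(ω))`, as an extended real: it is `-∞` where the
divergence is infinite. -/
def elbo (ν : ℝ) (ρ : ℝ≥0) (qθ : Measure ℝ) (qω : Measure (ι → ℝ)) : EReal :=
  ((∫ z, Real.log (B.blockCondLik z.1 z.2) ∂(qθ.prod qω) : ℝ) : EReal) -
    ((InformationTheory.klDiv (qθ.prod qω) (B.jointPrior ν ρ) : ℝ≥0∞) : EReal)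

/-- The precision `ρ⁻² + ∑ w_t e_t`. -/
def gaussPrec (ρ : ℝ≥0) (e : ι → ℝ) : ℝ :=
  ((ρ : ℝ) ^ 2)⁻¹ + ∑ t, B.w t * e t

/-- The Gaussian law with variance `σ² = (ρ⁻² + ∑ w_t e_t)⁻¹` and mean
`σ² (ρ⁻² ν + ∑ w_t κ_t)`. -/
def gaussUpdate (ν : ℝ) (ρ : ℝ≥0) (e : ι → ℝ) : Measure ℝ :=
  gaussianReal ((B.gaussPrec ρ e)⁻¹ * (((ρ : ℝ) ^ 2)⁻¹ * ν + ∑ t, B.w t * B.kappa t))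
    (B.gaussPrec ρ e)⁻¹.toNNReal

/-- The law of independent `ω_t ∼ PG(m_t, √(w_t s))`. -/
def pgUpdate (s : ℝ) : Measure (ι → ℝ) :=
  B.pgLaw (fun t => Real.sqrt (B.w t * s))

end LogisticBlock

end

/-! Two facts carry the theorem: Euler's product for cosh, and the observation that each optimal
factor is an exponential tilt of its prior.

A weighted sum of independent Gamma(b, 1) variables with weights a_k has Laplace transform ∏ (1 - t
a_k)^(-b). For the Pólya–Gamma weights each factor is a power of the quotient of two factors of
Euler's product, so E e^{tω} = (cosh(c/2) / cosh(√(c² - 2t)/2))^b for t ≤ 0 (`mgf_pgMeasure`). At c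
= 0, t = -θ²/2 this is cosh(θ/2)^(-b), and 1 + e^θ = 2 e^{θ/2} cosh(θ/2) turns it into the integral
representation of the logistic likelihood. Comparing Laplace transforms also shows that tilting
PG(b, 0) by -c²ω/2 gives PG(b, c) (`tilted_pgMeasure_zero`); differentiating gives the mean. The law
has a density because, given the other gamma variables, the sum is a nonconstant affine function of
the first.

The conditional log-likelihood is quadratic in θ and affine in ω. Hence the Gaussian prior tilts to
a Gaussian, by completing the square, and the Pólya–Gamma prior tilts to a Pólya–Gamma law. Gibbs'
identity ∫ f dq - KL(q ‖ π) = log ∫ e^f dπ - KL(q ‖ π_f), with π_f the tilt of π by f, then gives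
both coordinate updates with uniqueness, since the divergence of a product is the sum of the
divergences. Applied to the joint prior with f = log p(y ∣ θ, ω), it gives the evidence bound.

Integrability comes from r f ≤ r log r - r + e^f: a nonnegative function with an exponential moment
under the prior is integrable under every law of finite divergence (`integrable_of_klDiv_ne_top`).
For weights at most one, the comparison of evidences is Jensen's inequality for x ↦ x^w in each
factor. -/

section

open Filter Topology PolyaGamma

/-! ### Moments of the gamma law -/

namespace ProbabilityTheory

/-- The exponential moments of the law `Gamma(b, 1)`. -/
theorem lintegral_exp_mul_gammaMeasure {b t : ℝ} (hb : 0 < b) (ht : t < 1) :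
    ∫⁻ x, ENNReal.ofReal (Real.exp (t * x)) ∂(gammaMeasure b 1) =
      ENNReal.ofReal ((1 - t) ^ (-b)) := by
  have h1 : 0 < 1 - t := by linarith
  -- The factor e^{tx} only changes the rate from 1 to 1 - t, and the new gamma density has mass
  -- one.
  have key : ∀ x, gammaPDF b 1 x * ENNReal.ofReal (Real.exp (t * x)) =
      ENNReal.ofReal ((1 - t) ^ (-b)) * gammaPDF b (1 - t) x := by
    intro x
    rcases lt_or_ge x 0 with hx | hx
    · simp [gammaPDF_of_neg hx]
    · rw [gammaPDF_of_nonneg hx, gammaPDF_of_nonneg hx, ← ENNReal.ofReal_mul (by positivity),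
        ← ENNReal.ofReal_mul (by positivity)]
      congr 1
      have e : Real.exp (-((1 - t) * x)) = Real.exp (-(1 * x)) * Real.exp (t * x) := by
        rw [← Real.exp_add]; ring_nf
      rw [e, Real.rpow_neg h1.le, Real.one_rpow]
      have := (Real.rpow_pos_of_pos h1 b).ne'
      field_simp
  have hm : Measurable (gammaPDF b 1) := (measurable_gammaPDFReal b 1).ennreal_ofReal
  have hm' : Measurable (gammaPDF b (1 - t)) := (measurable_gammaPDFReal b _).ennreal_ofReal
  rw [gammaMeasure, lintegral_withDensity_eq_lintegral_mul _ hm (by fun_prop)]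
  simp only [Pi.mul_apply, key]
  rw [lintegral_const_mul _ hm', lintegral_gammaPDF_eq_one hb h1, mul_one]

theorem gammaMeasure_ae_pos {b : ℝ} : ∀ᵐ x ∂(gammaMeasure b 1), 0 < x := by
  have hm : Measurable (gammaPDF b 1) := (measurable_gammaPDFReal b 1).ennreal_ofReal
  rw [gammaMeasure, ae_withDensity_iff hm]
  -- The point 0 is discarded as a null set, because the density need not vanish there (for b = 1 it
  -- equals 1).
  filter_upwards [compl_mem_ae_iff.2 (measure_singleton (μ := (volume : Measure ℝ)) 0)] with x hx h
  by_contra hn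
  have : x < 0 := lt_of_le_of_ne (not_lt.1 hn) hx
  exact h (gammaPDF_of_neg this)

/-- Since Γ(b + 1) = b Γ(b), x times the Gamma(b, 1) density is b times the Gamma(b + 1, 1) density.
-/
theorem lintegral_id_gammaMeasure {b : ℝ} (hb : 0 < b) :
    ∫⁻ x, ENNReal.ofReal x ∂(gammaMeasure b 1) = ENNReal.ofReal b := by
  have key : ∀ x, gammaPDF b 1 x * ENNReal.ofReal x = ENNReal.ofReal b * gammaPDF (b + 1) 1 x := by
    intro x
    rcases lt_or_ge x 0 with hx | hx
    · simp [gammaPDF_of_neg hx]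
    · rw [gammaPDF_of_nonneg hx, gammaPDF_of_nonneg hx, ← ENNReal.ofReal_mul (by positivity),
        ← ENNReal.ofReal_mul (by positivity)]
      congr 1
      rcases hx.eq_or_lt with rfl | hx
      · simp [hb.ne']
      have e : x ^ (b + 1 - 1) = x ^ (b - 1) * x := by
        rw [← Real.rpow_add_one hx.ne']; ring_nf
      rw [e, Real.Gamma_add_one hb.ne', Real.one_rpow, Real.one_rpow]
      have := (Real.Gamma_pos_of_pos hb).ne'
      field_simp
  have hm : Measurable (gammaPDF b 1) := (measurable_gammaPDFReal b 1).ennreal_ofReal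
  have hm' : Measurable (gammaPDF (b + 1) 1) := (measurable_gammaPDFReal _ _).ennreal_ofReal
  rw [gammaMeasure, lintegral_withDensity_eq_lintegral_mul _ hm (by fun_prop)]
  simp only [Pi.mul_apply, key]
  rw [lintegral_const_mul _ hm', lintegral_gammaPDF_eq_one (by linarith) one_pos, mul_one]

end ProbabilityTheory

/-! ### Euler's product for cosh and the sum over half-integers -/

namespace PolyaGamma

/-- This is sin 2u = 2 sin u cos u for partial products: among the first 2n sine factors at 2z,
those with j + 1 even are the sine factors at z, and those with j + 1 odd are the cosine factors. -/
theorem prod_range_two_mul_sub (z : ℂ) (n : ℕ) :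
    ∏ j ∈ Finset.range (2 * n), ((1 : ℂ) - (2 * z) ^ 2 / ((j : ℂ) + 1) ^ 2) =
      (∏ j ∈ Finset.range n, ((1 : ℂ) - z ^ 2 / ((j : ℂ) + 1) ^ 2)) *
        ∏ j ∈ Finset.range n, ((1 : ℂ) - z ^ 2 / ((j : ℂ) + 1 / 2) ^ 2) := by
  induction n with
  | zero => simp
  | succ n ih =>
    rw [show 2 * (n + 1) = 2 * n + 1 + 1 by ring, Finset.prod_range_succ, Finset.prod_range_succ,
      ih, Finset.prod_range_succ, Finset.prod_range_succ]
    have h1 : (1 : ℂ) - (2 * z) ^ 2 / (((2 * n : ℕ) : ℂ) + 1) ^ 2 =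
        1 - z ^ 2 / ((n : ℂ) + 1 / 2) ^ 2 := by
      have : (((2 * n : ℕ) : ℂ) + 1) = 2 * ((n : ℂ) + 1 / 2) := by push_cast; ring
      rw [this, mul_pow, mul_pow, mul_div_mul_left _ _ (by norm_num)]
    have h2 : (1 : ℂ) - (2 * z) ^ 2 / (((2 * n + 1 : ℕ) : ℂ) + 1) ^ 2 =
        1 - z ^ 2 / ((n : ℂ) + 1) ^ 2 := by
      have : (((2 * n + 1 : ℕ) : ℂ) + 1) = 2 * ((n : ℂ) + 1) := by push_cast; ring
      rw [this, mul_pow, mul_pow, mul_div_mul_left _ _ (by norm_num)]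
    rw [h1, h2]
    ring

/-- Euler's product for the hyperbolic cosine. -/
theorem tendsto_prod_cosh (x : ℝ) :
    Tendsto (fun n : ℕ => ∏ k ∈ Finset.range n,
      (1 + x ^ 2 / (4 * Real.pi ^ 2 * ((k : ℝ) + 1 / 2) ^ 2))) atTop
      (𝓝 (Real.cosh (x / 2))) := by
  rcases eq_or_ne x 0 with rfl | hx
  · simp
  have hpi : (Real.pi : ℂ) ≠ 0 := by exact_mod_cast Real.pi_ne_zero
  have hxc : (x : ℂ) ≠ 0 := by exact_mod_cast hx
  -- Chosen so that πz = ix/2: then cos πz = cosh(x/2) and -z² = x²/(4π²). As x ≠ 0, sin πz ≠ 0 and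
  -- may be divided by.
  set z : ℂ := (x : ℂ) / (2 * Real.pi) * Complex.I with hz
  have hpz : (Real.pi : ℂ) * z = ((x / 2 : ℝ) : ℂ) * Complex.I := by
    rw [hz]; push_cast; field_simp
  have hsin : Complex.sin (Real.pi * z) ≠ 0 := by
    rw [hpz, Complex.sin_mul_I, ← Complex.ofReal_sinh]
    refine mul_ne_zero ?_ Complex.I_ne_zero
    have : Real.sinh (x / 2) ≠ 0 := by
      rw [Ne, Real.sinh_eq_zero]; simpa using hx
    exact_mod_cast this
  have hcos : Complex.cos (Real.pi * z) = ((Real.cosh (x / 2) : ℝ) : ℂ) := by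
    rw [hpz, Complex.cos_mul_I, Complex.ofReal_cosh]
  have A := Complex.tendsto_euler_sin_prod z
  have B := (Complex.tendsto_euler_sin_prod (2 * z)).comp
    (tendsto_id.const_mul_atTop' (r := 2) (by norm_num : 0 < 2))
  have C : Tendsto (fun n : ℕ => ∏ j ∈ Finset.range n, ((1 : ℂ) - z ^ 2 / ((j : ℂ) + 1 / 2) ^ 2))
      atTop (𝓝 (Complex.sin (Real.pi * (2 * z)) / (2 * Complex.sin (Real.pi * z)))) := by
    refine (B.div (A.const_mul 2) (mul_ne_zero two_ne_zero hsin)).congr' ?_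
    filter_upwards [A.eventually_ne hsin] with n hn
    simp only [Pi.div_apply, Function.comp_apply, id]
    rw [prod_range_two_mul_sub]
    rw [div_eq_iff (mul_ne_zero two_ne_zero hn)]
    ring
  have hdouble : Complex.sin (Real.pi * (2 * z)) / (2 * Complex.sin (Real.pi * z)) =
      ((Real.cosh (x / 2) : ℝ) : ℂ) := by
    rw [show (Real.pi : ℂ) * (2 * z) = 2 * (Real.pi * z) by ring, Complex.sin_two_mul, ← hcos]
    field_simp
  rw [hdouble] at C
  have D := (Complex.continuous_re.tendsto _).comp C
  rw [Complex.ofReal_re] at D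
  refine D.congr fun n => ?_
  simp only [Function.comp]
  rw [← Complex.ofReal_re (∏ k ∈ Finset.range n, _)]
  congr 1
  push_cast
  refine Finset.prod_congr rfl fun k _ => ?_
  have hk : ((k : ℂ) + 1 / 2) ≠ 0 := by
    have : (((k : ℝ) + 1 / 2 : ℝ) : ℂ) ≠ 0 := by
      rw [Complex.ofReal_ne_zero]; positivity
    simpa using this
  rw [hz, mul_pow, Complex.I_sq]
  field_simp
  ring

/-- Removing the even terms, a quarter of ζ(2) = π²/6, leaves π²/8 for the odd squares; 1/(k + 1/2)²
is four times an odd term. -/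
theorem hasSum_inv_half_sq :
    HasSum (fun k : ℕ => 1 / ((k : ℝ) + 1 / 2) ^ 2) (Real.pi ^ 2 / 2) := by
  have hs := hasSum_zeta_two
  have heven : HasSum (fun k : ℕ => (1 : ℝ) / ((2 * k : ℕ) : ℝ) ^ 2)
      (1 / 4 * (Real.pi ^ 2 / 6)) := by
    refine Eq.subst (motive := fun f => HasSum f _) (funext fun k => ?_) (hs.mul_left (1 / 4))
    push_cast
    ring
  have hodd : Summable (fun k : ℕ => (1 : ℝ) / ((2 * k + 1 : ℕ) : ℝ) ^ 2) :=
    hs.summable.comp_injective (i := fun k : ℕ => 2 * k + 1) (fun a b h => by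
      simpa using h)
  have h2 := (HasSum.even_add_odd (f := fun n : ℕ => (1 : ℝ) / (n : ℝ) ^ 2) heven
    hodd.hasSum).unique hs
  rw [show Real.pi ^ 2 / 2 = 4 * ∑' k : ℕ, (1 : ℝ) / ((2 * k + 1 : ℕ) : ℝ) ^ 2 by linarith]
  refine Eq.subst (motive := fun f => HasSum f _) (funext fun k => ?_) (hodd.hasSum.mul_left 4)
  have h0 : ((2 * k + 1 : ℕ) : ℝ) = 2 * ((k : ℝ) + 1 / 2) := by push_cast; ring
  have h1 : ((k : ℝ) + 1 / 2) ≠ 0 := by positivity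
  rw [h0]
  field_simp
  norm_num

end PolyaGamma

/-! ### Weighted sums of independent gamma variables -/

namespace PolyaGamma

/-- The law of a sequence of independent `Gamma(b, 1)` variables. -/
noncomputable abbrev gammaSeq (b : ℝ) : Measure (ℕ → ℝ) :=
  Measure.infinitePi (fun _ : ℕ => gammaMeasure b 1)

theorem isProbabilityMeasure_gammaSeq {b : ℝ} (hb : 0 < b) :
    IsProbabilityMeasure (gammaSeq b) := by
  have := isProbabilityMeasure_gammaMeasure hb one_pos
  infer_instance

theorem gammaSeq_map_eval {b : ℝ} (hb : 0 < b) (k : ℕ) :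
    (gammaSeq b).map (fun g => g k) = gammaMeasure b 1 := by
  have := isProbabilityMeasure_gammaMeasure hb one_pos
  exact Measure.infinitePi_map_eval _ k

theorem gammaSeq_ae_pos {b : ℝ} (hb : 0 < b) : ∀ᵐ g ∂(gammaSeq b), ∀ k, 0 < g k := by
  rw [ae_all_iff]
  intro k
  have h := gammaMeasure_ae_pos (b := b)
  rw [← gammaSeq_map_eval hb k] at h
  exact ae_of_ae_map (measurable_pi_apply k).aemeasurable h

/-- The weighted sum of a sequence. -/
noncomputable def weightedSum (a g : ℕ → ℝ) : ℝ := ∑' k, a k * g k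

theorem measurable_weightedSum (a : ℕ → ℝ) : Measurable (weightedSum a) :=
  Measurable.tsum fun k => (measurable_pi_apply (X := fun _ : ℕ => ℝ) k).const_mul (a k)

section

variable {a : ℕ → ℝ} {b : ℝ}

theorem lintegral_tsum_gammaSeq (hb : 0 < b) (ha : ∀ k, 0 < a k) (hs : Summable a) :
    ∫⁻ g, ∑' k, ENNReal.ofReal (a k * g k) ∂(gammaSeq b) = ENNReal.ofReal (b * ∑' k, a k) := by
  rw [lintegral_tsum (fun k => Measurable.aemeasurable (by fun_prop))]
  have : ∀ k, ∫⁻ g, ENNReal.ofReal (a k * g k) ∂(gammaSeq b) = ENNReal.ofReal (b * a k) := by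
    intro k
    simp_rw [ENNReal.ofReal_mul (ha k).le]
    rw [lintegral_const_mul _ (by fun_prop), mul_comm b, ENNReal.ofReal_mul (ha k).le,
      ← lintegral_id_gammaMeasure hb, ← gammaSeq_map_eval hb k,
      lintegral_map (by fun_prop) (by fun_prop)]
  simp_rw [this]
  rw [← tsum_mul_left, ENNReal.ofReal_tsum_of_nonneg (fun k => (mul_pos hb (ha k)).le)
    (hs.mul_left b)]

/-- The sum of the nonnegative terms has finite expectation, hence is finite almost surely. Without
this the `tsum` could take its default value 0. -/
theorem gammaSeq_ae_summable (hb : 0 < b) (ha : ∀ k, 0 < a k) (hs : Summable a) :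
    ∀ᵐ g ∂(gammaSeq b), Summable fun k => a k * g k := by
  have h := ae_lt_top (μ := gammaSeq b) (f := fun g => ∑' k, ENNReal.ofReal (a k * g k))
    (by fun_prop) (by rw [lintegral_tsum_gammaSeq hb ha hs]; exact ENNReal.ofReal_ne_top)
  filter_upwards [h, gammaSeq_ae_pos hb] with g hg hpos
  have h0 : ∀ k, 0 ≤ a k * g k := fun k => (mul_pos (ha k) (hpos k)).le
  have := ENNReal.summable_toReal hg.ne
  simpa only [ENNReal.toReal_ofReal (h0 _)] using this

theorem weightedSum_ae_pos (hb : 0 < b) (ha : ∀ k, 0 < a k) (hs : Summable a) :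
    ∀ᵐ g ∂(gammaSeq b), 0 < weightedSum a g := by
  filter_upwards [gammaSeq_ae_summable hb ha hs, gammaSeq_ae_pos hb] with g hg hpos
  exact hg.tsum_pos (fun k => (mul_pos (ha k) (hpos k)).le) 0 (mul_pos (ha 0) (hpos 0))

theorem lintegral_weightedSum (hb : 0 < b) (ha : ∀ k, 0 < a k) (hs : Summable a) :
    ∫⁻ g, ENNReal.ofReal (weightedSum a g) ∂(gammaSeq b) = ENNReal.ofReal (b * ∑' k, a k) := by
  rw [← lintegral_tsum_gammaSeq hb ha hs]
  refine lintegral_congr_ae ?_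
  filter_upwards [gammaSeq_ae_summable hb ha hs, gammaSeq_ae_pos hb] with g hg hpos
  exact ENNReal.ofReal_tsum_of_nonneg (fun k => (mul_pos (ha k) (hpos k)).le) hg

theorem lintegral_exp_sum_gammaSeq (hb : 0 < b) {t : ℝ} (ht : ∀ k, t * a k < 1) (n : ℕ) :
    ∫⁻ g, ENNReal.ofReal (Real.exp (t * ∑ k ∈ Finset.range n, a k * g k)) ∂(gammaSeq b) =
      ENNReal.ofReal (∏ k ∈ Finset.range n, (1 - t * a k) ^ (-b)) := by
  have := isProbabilityMeasure_gammaMeasure hb one_pos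
  have hind : iIndepFun (fun k (g : ℕ → ℝ) => ENNReal.ofReal (Real.exp (t * a k * g k)))
      (gammaSeq b) :=
    iIndepFun_infinitePi (P := fun _ : ℕ => gammaMeasure b 1)
      (X := fun k x => ENNReal.ofReal (Real.exp (t * a k * x))) (fun k => by fun_prop)
  have h1 := lintegral_prod_eq_prod_lintegral_of_indepFun (Finset.range n) _ hind
    (fun k => by fun_prop)
  rw [ENNReal.ofReal_prod_of_nonneg (fun k _ => Real.rpow_nonneg (by linarith [ht k]) _)]
  convert h1 using 1
  · refine lintegral_congr fun g => ?_
    rw [Finset.mul_sum, Real.exp_sum, ENNReal.ofReal_prod_of_nonneg (fun k _ => (Real.exp_pos _).le)]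
    simp only [mul_assoc]
  · refine Finset.prod_congr rfl fun k _ => ?_
    rw [← lintegral_exp_mul_gammaMeasure hb (ht k), ← gammaSeq_map_eval hb k,
      lintegral_map (by fun_prop) (by fun_prop)]

/-- For t ≤ 0 the exponentials of the partial sums are almost surely at most 1, so dominated
convergence applies. -/
theorem tendsto_integral_exp_weightedSum (hb : 0 < b) (ha : ∀ k, 0 < a k) (hs : Summable a)
    {t : ℝ} (ht : t ≤ 0) :
    Tendsto (fun n => ∏ k ∈ Finset.range n, (1 - t * a k) ^ (-b)) atTop
      (𝓝 (∫ g, Real.exp (t * weightedSum a g) ∂(gammaSeq b))) := by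
  have := isProbabilityMeasure_gammaSeq hb
  have hta : ∀ k, t * a k < 1 := fun k =>
    (mul_nonpos_of_nonpos_of_nonneg ht (ha k).le).trans_lt one_pos
  have e : ∀ n, ∏ k ∈ Finset.range n, (1 - t * a k) ^ (-b) =
      ∫ g, Real.exp (t * ∑ k ∈ Finset.range n, a k * g k) ∂(gammaSeq b) := by
    intro n
    rw [integral_eq_lintegral_of_nonneg_ae (ae_of_all _ fun g => (Real.exp_pos _).le)
      (Measurable.aestronglyMeasurable (by fun_prop)), lintegral_exp_sum_gammaSeq hb hta,
      ENNReal.toReal_ofReal]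
    exact Finset.prod_nonneg fun k _ => Real.rpow_nonneg (by linarith [hta k]) _
  simp_rw [e]
  refine tendsto_integral_of_dominated_convergence (fun _ => 1)
    (fun n => Measurable.aestronglyMeasurable (by fun_prop))
    (integrable_const 1) (fun n => ?_) ?_
  · filter_upwards [gammaSeq_ae_pos hb] with g hpos
    rw [Real.norm_of_nonneg (Real.exp_pos _).le, Real.exp_le_one_iff]
    exact mul_nonpos_of_nonpos_of_nonneg ht
      (Finset.sum_nonneg fun k _ => (mul_pos (ha k) (hpos k)).le)
  · filter_upwards [gammaSeq_ae_summable hb ha hs] with g hg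
    exact (Real.continuous_exp.tendsto _).comp (hg.hasSum.tendsto_sum_nat.const_mul t)

theorem integrable_exp_weightedSum_of_nonpos (hb : 0 < b) (ha : ∀ k, 0 < a k) (hs : Summable a)
    {t : ℝ} (ht : t ≤ 0) :
    Integrable (fun g => Real.exp (t * weightedSum a g)) (gammaSeq b) := by
  have := isProbabilityMeasure_gammaSeq hb
  refine Integrable.of_bound (C := 1)
    (Real.measurable_exp.comp ((measurable_weightedSum a).const_mul t)).aestronglyMeasurable ?_
  filter_upwards [weightedSum_ae_pos hb ha hs] with g hpos
  rw [Real.norm_of_nonneg (Real.exp_pos _).le, Real.exp_le_one_iff]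
  exact mul_nonpos_of_nonpos_of_nonneg ht hpos.le

/-- On [0, 1/2] one has 1/(1 - x) ≤ 1 + 2x ≤ e^{2x}. This bounds the partial products by the
exponential of a convergent sum. -/
theorem one_sub_rpow_neg_le (hb : 0 < b) {x : ℝ} (hx : 0 ≤ x) (hx' : x ≤ 1 / 2) :
    (1 - x) ^ (-b) ≤ Real.exp (2 * b * x) := by
  have h1 : 0 < 1 - x := by linarith
  have h2 : (1 - x)⁻¹ ≤ Real.exp (2 * x) := by
    refine le_trans ?_ (Real.add_one_le_exp (2 * x))
    rw [inv_le_iff_one_le_mul₀ h1]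
    nlinarith
  rw [Real.rpow_neg h1.le, ← Real.inv_rpow h1.le]
  calc (1 - x)⁻¹ ^ b ≤ Real.exp (2 * x) ^ b :=
        Real.rpow_le_rpow (inv_nonneg.2 h1.le) h2 hb.le
    _ = Real.exp (2 * b * x) := by rw [← Real.exp_mul]; ring_nf

/-- For t ≥ 0 the constant bound of the nonpositive case is lost; Fatou's lemma together with a
uniform bound on the partial products replaces it. -/
theorem integrable_exp_weightedSum (hb : 0 < b) (ha : ∀ k, 0 < a k) (hs : Summable a)
    {t : ℝ} (ht : 0 ≤ t) (hta : ∀ k, t * a k ≤ 1 / 2) :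
    Integrable (fun g => Real.exp (t * weightedSum a g)) (gammaSeq b) := by
  refine ⟨(Real.measurable_exp.comp
    ((measurable_weightedSum a).const_mul t)).aestronglyMeasurable, ?_⟩
  rw [hasFiniteIntegral_iff_ofReal (ae_of_all _ fun g => (Real.exp_pos _).le)]
  have hlim : ∀ᵐ g ∂(gammaSeq b), ENNReal.ofReal (Real.exp (t * weightedSum a g)) =
      liminf (fun n => ENNReal.ofReal (Real.exp (t * ∑ k ∈ Finset.range n, a k * g k))) atTop := by
    filter_upwards [gammaSeq_ae_summable hb ha hs] with g hg
    exact (((ENNReal.continuous_ofReal.comp Real.continuous_exp).tendsto _).comp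
      (hg.hasSum.tendsto_sum_nat.const_mul t)).liminf_eq.symm
  rw [lintegral_congr_ae hlim]
  refine (lintegral_liminf_le fun n => by fun_prop).trans_lt ?_
  refine lt_of_le_of_lt ?_ (ENNReal.ofReal_lt_top (r := Real.exp (2 * b * (t * ∑' k, a k))))
  refine (liminf_le_liminf (v := fun _ => ENNReal.ofReal (Real.exp (2 * b * (t * ∑' k, a k))))
    (Eventually.of_forall fun n => ?_)).trans (by simp)
  rw [lintegral_exp_sum_gammaSeq hb (fun k => (hta k).trans_lt (by norm_num))]
  refine ENNReal.ofReal_le_ofReal ?_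
  calc ∏ k ∈ Finset.range n, (1 - t * a k) ^ (-b)
      ≤ ∏ k ∈ Finset.range n, Real.exp (2 * b * (t * a k)) :=
        Finset.prod_le_prod (fun k _ => Real.rpow_nonneg (by linarith [hta k]) _)
          (fun k _ => one_sub_rpow_neg_le hb (mul_nonneg ht (ha k).le) (hta k))
    _ = Real.exp (2 * b * (t * ∑ k ∈ Finset.range n, a k)) := by
        rw [← Real.exp_sum, Finset.mul_sum, Finset.mul_sum]
    _ ≤ _ := by
        gcongr
        exact hs.sum_le_tsum _ fun k _ => (ha k).le

/-- Splits off the variable of index 0 as an independent factor, so that one can integrate over it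
with the tail fixed. Both laws are compared on finite-dimensional boxes. -/
theorem gammaSeq_eq_map_cons (hb : 0 < b) :
    ((gammaSeq b).prod (gammaMeasure b 1)).map
      (fun p : (ℕ → ℝ) × ℝ => fun n : ℕ => Nat.casesOn (motive := fun _ => ℝ) n p.2 p.1) =
      gammaSeq b := by
  have := isProbabilityMeasure_gammaMeasure hb one_pos
  have hmeas : Measurable (fun p : (ℕ → ℝ) × ℝ => fun n : ℕ =>
      Nat.casesOn (motive := fun _ => ℝ) n p.2 p.1) := by
    refine measurable_pi_iff.2 fun n => ?_
    cases n with
    | zero => exact measurable_snd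
    | succ n => exact (measurable_pi_apply n).comp measurable_fst
  refine Measure.eq_infinitePi _ fun s t ht => ?_
  classical
  have hpre : (fun p : (ℕ → ℝ) × ℝ => fun n : ℕ =>
      Nat.casesOn (motive := fun _ => ℝ) n p.2 p.1) ⁻¹' (Set.pi s t) =
      (Set.pi (s.preimage Nat.succ Nat.succ_injective.injOn : Finset ℕ) fun i => t (i + 1)) ×ˢ
        (if 0 ∈ s then t 0 else univ) := by
    ext p
    simp only [Set.mem_preimage, Set.mem_pi, Set.mem_prod, Finset.coe_preimage, Finset.mem_coe]
    constructor
    · intro h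
      refine ⟨fun i hi => h (i + 1) hi, ?_⟩
      split_ifs with h0
      · exact h 0 h0
      · trivial
    · rintro ⟨h1, h2⟩ i hi
      cases i with
      | zero => simpa [hi] using h2
      | succ i => exact h1 i hi
  rw [Measure.map_apply hmeas (MeasurableSet.pi s.countable_toSet fun i _ => ht i), hpre,
    Measure.prod_prod, Measure.infinitePi_pi _ (fun i _ => ht _),
    Finset.prod_preimage' Nat.succ s Nat.succ_injective.injOn
      (fun i => gammaMeasure b 1 (t i)),
    ← Finset.prod_filter_mul_prod_filter_not s (fun i => i ∈ Set.range Nat.succ)]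
  congr 1
  have hz : s.filter (fun i => i ∉ Set.range Nat.succ) = if 0 ∈ s then {0} else ∅ := by
    ext i
    cases i with
    | zero => split_ifs with h <;> simp [h]
    | succ i => split_ifs <;> simp
  rw [hz]
  split_ifs <;> simp

/-- The law of a weighted sum of independent gamma variables has a density. -/
theorem map_weightedSum_absolutelyContinuous (hb : 0 < b) (ha : ∀ k, 0 < a k) (hs : Summable a) :
    (gammaSeq b).map (weightedSum a) ≪ volume := by
  have := isProbabilityMeasure_gammaMeasure hb one_pos
  have hmeas : Measurable (fun p : (ℕ → ℝ) × ℝ => fun n : ℕ =>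
      Nat.casesOn (motive := fun _ => ℝ) n p.2 p.1) := by
    refine measurable_pi_iff.2 fun n => ?_
    cases n with
    | zero => exact measurable_snd
    | succ n => exact (measurable_pi_apply n).comp measurable_fst
  have hmS := measurable_weightedSum (fun k => a (k + 1))
  have hsum : Measurable (fun p : (ℕ → ℝ) × ℝ =>
      weightedSum (fun k => a (k + 1)) p.1 + a 0 * p.2) :=
    (hmS.comp measurable_fst).add (measurable_snd.const_mul _)
  have key : (gammaSeq b).map (weightedSum a) = ((gammaSeq b).prod (gammaMeasure b 1)).map
      (fun p => weightedSum (fun k => a (k + 1)) p.1 + a 0 * p.2) := by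
    conv_lhs => rw [← gammaSeq_eq_map_cons hb]
    rw [Measure.map_map (measurable_weightedSum a) hmeas]
    refine Measure.map_congr ?_
    have h := gammaSeq_ae_summable hb ha hs
    rw [← gammaSeq_eq_map_cons hb] at h
    filter_upwards [ae_of_ae_map hmeas.aemeasurable h] with p hp
    simp only [Function.comp, weightedSum]
    rw [hp.tsum_eq_zero_add, add_comm]
    rfl
  rw [key]
  refine Measure.AbsolutelyContinuous.mk fun N hN hN0 => ?_
  rw [Measure.map_apply hsum hN, Measure.measure_prod_null (hsum hN)]
  -- With the tail g fixed, the sum is an affine function of the remaining gamma variable with slope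
  -- `a 0` ≠ 0, so it pulls null sets back to null sets.
  refine ae_of_all _ fun g => ?_
  have hac : gammaMeasure b 1 ≪ volume := withDensity_absolutelyContinuous _ _
  refine hac ?_
  have hq : Measure.QuasiMeasurePreserving
      (fun x : ℝ => weightedSum (fun k => a (k + 1)) g + a 0 * x) volume volume := by
    refine ⟨by fun_prop, ?_⟩
    have e : (fun x : ℝ => weightedSum (fun k => a (k + 1)) g + a 0 * x) =
        (fun x => weightedSum (fun k => a (k + 1)) g + x) ∘ (fun x => a 0 * x) := rfl
    rw [e, ← Measure.map_map (by fun_prop) (by fun_prop), Real.map_volume_mul_left (ha 0).ne',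
      Measure.map_smul, map_add_left_eq_self]
    exact Measure.smul_absolutelyContinuous
  exact hq.preimage_null hN0

end

end PolyaGamma

/-! ### Uniqueness of the Laplace transform -/

namespace ProbabilityTheory

/-- A finite measure with exponential moments is determined by its Laplace transform. -/
theorem ext_of_mgf_eqOn_nonpos {μ μ' : Measure ℝ} [IsFiniteMeasure μ] [IsFiniteMeasure μ']
    (h : (0 : ℝ) ∈ interior (integrableExpSet id μ))
    (h' : (0 : ℝ) ∈ interior (integrableExpSet id μ'))
    (heq : ∀ t ≤ 0, mgf id μ t = mgf id μ' t) : μ = μ' := by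
  set U : Set ℝ := interior (integrableExpSet id μ) ∩ interior (integrableExpSet id μ') with hU
  have hconv : Convex ℝ U := convex_integrableExpSet.interior.inter convex_integrableExpSet.interior
  have hopen : IsOpen U := isOpen_interior.inter isOpen_interior
  have h0 : (0 : ℝ) ∈ U := ⟨h, h'⟩
  have hX : AnalyticOnNhd ℂ (complexMGF id μ) {z | z.re ∈ U} := fun z hz =>
    analyticAt_complexMGF hz.1
  have hY : AnalyticOnNhd ℂ (complexMGF id μ') {z | z.re ∈ U} := fun z hz =>
    analyticAt_complexMGF hz.2
  have hEq : Set.EqOn (complexMGF id μ) (complexMGF id μ') {z | z.re ∈ U} := by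
    refine AnalyticOnNhd.eqOn_of_preconnected_of_frequently_eq hX hY
      (hconv.linear_preimage Complex.reLm).isPreconnected (z₀ := (0 : ℂ)) (by simpa using h0) ?_
    -- The transforms agree at the points -1/(n + 1), which accumulate at 0. The identity theorem
    -- extends this to a strip containing the imaginary axis, where they are the characteristic
    -- functions.
    have hseq : Tendsto (fun n : ℕ => ((-(1 / ((n : ℝ) + 1)) : ℝ) : ℂ)) atTop (𝓝[≠] 0) := by
      refine tendsto_nhdsWithin_iff.2 ⟨?_, Eventually.of_forall fun n => ?_⟩
      · rw [← Complex.ofReal_zero, tendsto_ofReal_iff]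
        simpa using tendsto_one_div_add_atTop_nhds_zero_nat (𝕜 := ℝ).neg
      · have : (0 : ℝ) < 1 / ((n : ℝ) + 1) := by positivity
        simp only [Set.mem_compl_iff, Set.mem_singleton_iff, Complex.ofReal_eq_zero]
        linarith
    refine hseq.frequently (Eventually.frequently (Eventually.of_forall fun n => ?_))
    rw [complexMGF_ofReal, complexMGF_ofReal, heq]
    have : (0 : ℝ) < 1 / ((n : ℝ) + 1) := by positivity
    linarith
  refine Measure.ext_of_charFun (funext fun t => ?_)
  rw [← complexMGF_id_mul_I, ← complexMGF_id_mul_I]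
  exact hEq (by simpa using h0)

end ProbabilityTheory

/-! ### Pólya–Gamma laws: Laplace transform, tilting, mean -/

namespace PolyaGamma

/-- The coefficients of the gamma variables in the series that defines `PG(b, c)`. -/
noncomputable def pgCoeff (c : ℝ) (k : ℕ) : ℝ :=
  1 / (2 * Real.pi ^ 2) / (((k : ℝ) + 1 / 2) ^ 2 + c ^ 2 / (4 * Real.pi ^ 2))

theorem pgCoeff_pos (c : ℝ) (k : ℕ) : 0 < pgCoeff c k := by
  unfold pgCoeff; positivity

theorem pgCoeff_zero_right (k : ℕ) :
    pgCoeff 0 k = 1 / (2 * Real.pi ^ 2) * (1 / ((k : ℝ) + 1 / 2) ^ 2) := by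
  unfold pgCoeff
  simp
  ring

theorem hasSum_pgCoeff_zero : HasSum (pgCoeff 0) (1 / 4) := by
  have h := hasSum_inv_half_sq.mul_left (1 / (2 * Real.pi ^ 2))
  rw [show pgCoeff 0 = _ from funext pgCoeff_zero_right]
  rwa [show 1 / (2 * Real.pi ^ 2) * (Real.pi ^ 2 / 2) = 1 / 4 by field_simp; norm_num] at h

theorem pgCoeff_le (c : ℝ) (k : ℕ) : pgCoeff c k ≤ pgCoeff 0 k := by
  unfold pgCoeff
  have : 0 ≤ c ^ 2 / (4 * Real.pi ^ 2) := by positivity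
  refine div_le_div_of_nonneg_left (by positivity) (by positivity) ?_
  rw [zero_pow two_ne_zero, zero_div]
  linarith

theorem summable_pgCoeff (c : ℝ) : Summable (pgCoeff c) :=
  Summable.of_nonneg_of_le (fun k => (pgCoeff_pos c k).le) (pgCoeff_le c)
    hasSum_pgCoeff_zero.summable

/-- A single coefficient is at most the whole sum at c = 0. This crude bound ensures t a_k ≤ 1/2 for
0 ≤ t ≤ 2. -/
theorem pgCoeff_le_quarter (c : ℝ) (k : ℕ) : pgCoeff c k ≤ 1 / 4 :=
  (pgCoeff_le c k).trans
    (le_hasSum hasSum_pgCoeff_zero k fun j _ => (pgCoeff_pos 0 j).le)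

theorem pgMeasure_eq_map (b c : ℝ) :
    pgMeasure b c = (gammaSeq b).map (weightedSum (pgCoeff c)) := by
  unfold pgMeasure
  congr 1
  ext g
  rw [weightedSum, ← tsum_mul_left]
  refine tsum_congr fun k => ?_
  unfold pgCoeff
  ring

theorem isProbabilityMeasure_pgMeasure {b : ℝ} (hb : 0 < b) (c : ℝ) :
    IsProbabilityMeasure (pgMeasure b c) := by
  have := isProbabilityMeasure_gammaSeq hb
  rw [pgMeasure_eq_map]
  exact Measure.isProbabilityMeasure_map (measurable_weightedSum _).aemeasurable

theorem pgMeasure_ae_pos {b : ℝ} (hb : 0 < b) (c : ℝ) : ∀ᵐ x ∂(pgMeasure b c), 0 < x := by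
  rw [pgMeasure_eq_map, ae_map_iff (measurable_weightedSum _).aemeasurable measurableSet_Ioi]
  exact weightedSum_ae_pos hb (pgCoeff_pos c) (summable_pgCoeff c)

theorem pgMeasure_absolutelyContinuous {b : ℝ} (hb : 0 < b) (c : ℝ) : pgMeasure b c ≪ volume := by
  rw [pgMeasure_eq_map]
  exact map_weightedSum_absolutelyContinuous hb (pgCoeff_pos c) (summable_pgCoeff c)

/-- The threshold 2 is not sharp. It suffices that 0 is interior to the domain of the transform and
that t = 1 is allowed. -/
theorem integrable_exp_mul_pgMeasure {b : ℝ} (hb : 0 < b) (c : ℝ) {t : ℝ} (ht : t ≤ 2) :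
    Integrable (fun x => Real.exp (t * x)) (pgMeasure b c) := by
  rw [pgMeasure_eq_map, integrable_map_measure (Measurable.aestronglyMeasurable (by fun_prop))
    (measurable_weightedSum _).aemeasurable]
  rcases le_total t 0 with h | h
  · exact integrable_exp_weightedSum_of_nonpos hb (pgCoeff_pos c) (summable_pgCoeff c) h
  · refine integrable_exp_weightedSum hb (pgCoeff_pos c) (summable_pgCoeff c) h fun k => ?_
    nlinarith [pgCoeff_le_quarter c k, pgCoeff_pos c k]

theorem Iio_subset_interior_integrableExpSet {b : ℝ} (hb : 0 < b) (c : ℝ) :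
    Iio 2 ⊆ interior (integrableExpSet id (pgMeasure b c)) :=
  interior_maximal (fun _ ht => integrable_exp_mul_pgMeasure hb c (le_of_lt ht)) isOpen_Iio

/-- The Laplace transform of `PG(b, c)`. -/
theorem mgf_pgMeasure {b : ℝ} (hb : 0 < b) (c : ℝ) {t : ℝ} (ht : t ≤ 0) :
    mgf id (pgMeasure b c) t =
      (Real.cosh (c / 2) / Real.cosh (Real.sqrt (c ^ 2 - 2 * t) / 2)) ^ b := by
  have hlim := tendsto_integral_exp_weightedSum hb (pgCoeff_pos c) (summable_pgCoeff c) ht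
  have hint : mgf id (pgMeasure b c) t =
      ∫ g, Real.exp (t * weightedSum (pgCoeff c) g) ∂(gammaSeq b) := by
    rw [pgMeasure_eq_map, mgf, integral_map (measurable_weightedSum _).aemeasurable
      (Measurable.aestronglyMeasurable (by fun_prop))]
    rfl
  rw [hint]
  refine tendsto_nhds_unique hlim ?_
  have hc := tendsto_prod_cosh c
  have hd := tendsto_prod_cosh (Real.sqrt (c ^ 2 - 2 * t))
  have hq := ((hc.div hd (Real.cosh_pos _).ne').rpow_const (p := b)
    (Or.inl (div_pos (Real.cosh_pos _) (Real.cosh_pos _)).ne'))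
  refine hq.congr fun n => ?_
  have hnn : 0 ≤ c ^ 2 - 2 * t := by nlinarith [sq_nonneg c]
  rw [Real.sq_sqrt hnn, Pi.div_apply, ← Finset.prod_div_distrib,
    ← Real.finsetProd_rpow _ _ (fun k _ => by positivity)]
  refine Finset.prod_congr rfl fun k _ => ?_
  have hta : 0 < 1 - t * pgCoeff c k := by
    nlinarith [mul_nonneg (neg_nonneg.2 ht) (pgCoeff_pos c k).le]
  rw [Real.rpow_neg hta.le, ← Real.inv_rpow hta.le]
  congr 1
  -- Factor by factor: with D = 4π²(k + 1/2)², (1 + c²/D) / (1 + (c² - 2t)/D) is the inverse of 1 -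
  -- t a_k.
  refine eq_inv_of_mul_eq_one_left ?_
  rw [pgCoeff]
  have h1 : (0 : ℝ) < (k : ℝ) + 1 / 2 := by positivity
  have h2 : 0 < 4 * Real.pi ^ 2 * ((k : ℝ) + 1 / 2) ^ 2 + (c ^ 2 - 2 * t) := by positivity
  have h3 : 0 < 4 * Real.pi ^ 2 * ((k : ℝ) + 1 / 2) ^ 2 + c ^ 2 := by positivity
  have hpi := Real.pi_pos
  have e1 : 1 + c ^ 2 / (4 * Real.pi ^ 2 * ((k : ℝ) + 1 / 2) ^ 2) =
      (4 * Real.pi ^ 2 * ((k : ℝ) + 1 / 2) ^ 2 + c ^ 2) /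
        (4 * Real.pi ^ 2 * ((k : ℝ) + 1 / 2) ^ 2) := by field_simp
  have e2 : 1 + (c ^ 2 - 2 * t) / (4 * Real.pi ^ 2 * ((k : ℝ) + 1 / 2) ^ 2) =
      (4 * Real.pi ^ 2 * ((k : ℝ) + 1 / 2) ^ 2 + (c ^ 2 - 2 * t)) /
        (4 * Real.pi ^ 2 * ((k : ℝ) + 1 / 2) ^ 2) := by field_simp
  have e3 : 1 / (2 * Real.pi ^ 2) / (((k : ℝ) + 1 / 2) ^ 2 + c ^ 2 / (4 * Real.pi ^ 2)) =
      2 / (4 * Real.pi ^ 2 * ((k : ℝ) + 1 / 2) ^ 2 + c ^ 2) := by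
    have : ((k : ℝ) + 1 / 2) ^ 2 + c ^ 2 / (4 * Real.pi ^ 2) =
      (4 * Real.pi ^ 2 * ((k : ℝ) + 1 / 2) ^ 2 + c ^ 2) / (4 * Real.pi ^ 2) := by field_simp
    rw [this]
    field_simp
    norm_num
  rw [e1, e2, e3, div_div_div_cancel_right₀ (by positivity)]
  rw [div_mul_eq_mul_div, div_eq_one_iff_eq h2.ne']
  field_simp
  ring

theorem integral_exp_mul_pgMeasure_zero {b : ℝ} (hb : 0 < b) (s : ℝ) :
    ∫ x, Real.exp (-(x * s ^ 2 / 2)) ∂(pgMeasure b 0) = (Real.cosh (s / 2)) ^ (-b) := by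
  have h := mgf_pgMeasure hb 0 (t := -(s ^ 2 / 2)) (by nlinarith [sq_nonneg s])
  have e : (0 : ℝ) ^ 2 - 2 * -(s ^ 2 / 2) = s ^ 2 := by ring
  rw [e, Real.sqrt_sq_eq_abs, zero_div, Real.cosh_zero, one_div,
    show |s| / 2 = |s / 2| by rw [abs_div, abs_two], Real.cosh_abs,
    Real.inv_rpow (Real.cosh_pos _).le, ← Real.rpow_neg (Real.cosh_pos _).le] at h
  rw [← h, mgf]
  refine integral_congr_ae (ae_of_all _ fun x => ?_)
  simp only [id]
  congr 1
  ring

/-- The transform of the tilt at t is the quotient of the PG(b, 0) transforms at t - c²/2 and at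
-c²/2, which is the PG(b, c) transform; uniqueness concludes. -/
theorem tilted_pgMeasure_zero {b : ℝ} (hb : 0 < b) (c : ℝ) :
    (pgMeasure b 0).tilted (fun x => -(c ^ 2 / 2) * x) = pgMeasure b c := by
  have := isProbabilityMeasure_pgMeasure hb 0
  have := isProbabilityMeasure_pgMeasure hb c
  have hc2 : -(c ^ 2 / 2) ≤ 0 := by nlinarith [sq_nonneg c]
  have hint := integrable_exp_mul_pgMeasure hb 0 (hc2.trans zero_le_two)
  have := isProbabilityMeasure_tilted hint
  refine ext_of_mgf_eqOn_nonpos ?_ ?_ ?_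
  · refine interior_maximal (t := Iio 2) (fun t ht => ?_) isOpen_Iio (by simp)
    refine (integrable_tilted_iff hint _).2 ?_
    simp only [smul_eq_mul, ← Real.exp_add, id, ← add_mul]
    exact integrable_exp_mul_pgMeasure hb 0 (by linarith [show t < 2 from ht])
  · exact Iio_subset_interior_integrableExpSet hb c (by simp)
  · intro t ht
    have h1 : mgf id ((pgMeasure b 0).tilted (fun x => -(c ^ 2 / 2) * x)) t =
        mgf id (pgMeasure b 0) (-(c ^ 2 / 2) + t) / mgf id (pgMeasure b 0) (-(c ^ 2 / 2)) := by
      rw [mgf, integral_exp_tilted, mgf, mgf]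
      simp only [id, Pi.add_apply, add_mul]
    rw [h1, mgf_pgMeasure hb 0 (by linarith), mgf_pgMeasure hb 0 hc2, mgf_pgMeasure hb c ht,
      ← Real.div_rpow (div_pos (Real.cosh_pos _) (Real.cosh_pos _)).le
        (div_pos (Real.cosh_pos _) (Real.cosh_pos _)).le]
    congr 1
    rw [show (0 : ℝ) ^ 2 - 2 * (-(c ^ 2 / 2) + t) = c ^ 2 - 2 * t by ring,
      show (0 : ℝ) ^ 2 - 2 * (-(c ^ 2 / 2)) = c ^ 2 by ring, Real.sqrt_sq_eq_abs,
      show |c| / 2 = |c / 2| by rw [abs_div, abs_two], Real.cosh_abs, zero_div, Real.cosh_zero]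
    have := (Real.cosh_pos (c / 2)).ne'
    have := (Real.cosh_pos (Real.sqrt (c ^ 2 - 2 * t) / 2)).ne'
    field_simp

theorem integrable_id_pgMeasure {b : ℝ} (hb : 0 < b) (c : ℝ) :
    Integrable (fun x : ℝ => x) (pgMeasure b c) :=
  integrable_of_mem_interior_integrableExpSet (X := id)
    (Iio_subset_interior_integrableExpSet hb c (by simp))

theorem integral_id_pgMeasure_zero {b : ℝ} (hb : 0 < b) : ∫ x, x ∂(pgMeasure b 0) = b / 4 := by
  rw [integral_eq_lintegral_of_nonneg_ae ((pgMeasure_ae_pos hb 0).mono fun x hx => hx.le)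
    (by fun_prop), pgMeasure_eq_map, lintegral_map (by fun_prop) (measurable_weightedSum _),
    lintegral_weightedSum hb (pgCoeff_pos 0) (summable_pgCoeff 0), hasSum_pgCoeff_zero.tsum_eq,
    ENNReal.toReal_ofReal (by positivity)]
  ring

/-- The mean of `PG(b, c)`. -/
theorem integral_id_pgMeasure {b : ℝ} (hb : 0 < b) (c : ℝ) :
    ∫ x, x ∂(pgMeasure b c) = pgMean b c := by
  unfold pgMean
  split_ifs with hc
  · rw [hc, integral_id_pgMeasure_zero hb]
  have hc2 : 0 < c ^ 2 := by positivity
  -- The function r ↦ E e^{-r²ω/2} = cosh(r/2)^(-b) is differentiated at c in two ways. The chain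
  -- rule contributes a factor -c, which is why c = 0 is treated separately.
  have hmem : -(c ^ 2 / 2) ∈ interior (integrableExpSet id (pgMeasure b 0)) :=
    Iio_subset_interior_integrableExpSet hb 0 (by simp only [mem_Iio]; linarith)
  have hd := hasDerivAt_mgf hmem
  have hq : HasDerivAt (fun r : ℝ => -(r ^ 2 / 2)) (-c) c := by
    refine ((hasDerivAt_pow 2 c).div_const 2).neg.congr_deriv ?_
    norm_num
  have h1 := hd.comp c hq
  have h2 : HasDerivAt (fun r : ℝ => (Real.cosh (r / 2)) ^ (-b))
      (Real.sinh (c / 2) * (1 / 2) * (-b) * Real.cosh (c / 2) ^ (-b - 1)) c :=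
    (((Real.hasDerivAt_cosh _).comp c ((hasDerivAt_id c).div_const 2))).rpow_const
      (Or.inl (Real.cosh_pos _).ne')
  have hfun : (mgf id (pgMeasure b 0) ∘ fun r : ℝ => -(r ^ 2 / 2)) =
      fun r : ℝ => (Real.cosh (r / 2)) ^ (-b) := by
    ext r
    rw [← integral_exp_mul_pgMeasure_zero hb r]
    simp only [Function.comp, mgf, id]
    refine integral_congr_ae (ae_of_all _ fun x => ?_)
    exact congrArg Real.exp (by ring : -(r ^ 2 / 2) * x = -(x * r ^ 2 / 2))
  rw [hfun] at h1
  have h3 := h1.unique h2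
  have hZ : ∫ x, Real.exp (-(c ^ 2 / 2) * x) ∂(pgMeasure b 0) = Real.cosh (c / 2) ^ (-b) :=
    congrFun hfun c
  rw [← tilted_pgMeasure_zero hb c, integral_tilted, hZ]
  have hC := Real.cosh_pos (c / 2)
  have h4 : ∫ x, (Real.exp (-(c ^ 2 / 2) * x) / Real.cosh (c / 2) ^ (-b)) • x ∂(pgMeasure b 0) =
      (∫ x, id x * Real.exp (-(c ^ 2 / 2) * id x) ∂(pgMeasure b 0)) /
        Real.cosh (c / 2) ^ (-b) := by
    rw [← integral_div]
    refine integral_congr_ae (ae_of_all _ fun x => ?_)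
    simp only [id, smul_eq_mul]
    ring
  rw [h4, Real.tanh_eq_sinh_div_cosh]
  rw [Real.rpow_sub_one hC.ne'] at h3
  have hCb := (Real.rpow_pos_of_pos hC (-b)).ne'
  have h5 : (∫ x, id x * Real.exp (-(c ^ 2 / 2) * id x) ∂(pgMeasure b 0)) =
      Real.sinh (c / 2) * b * (Real.cosh (c / 2) ^ (-b) / Real.cosh (c / 2)) / (2 * c) := by
    rw [eq_div_iff (mul_ne_zero two_ne_zero hc)]
    linear_combination (-2) * h3
  rw [h5]
  field_simp

end PolyaGamma

/-! ### Kullback–Leibler divergence and Gibbs' variational principle -/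

namespace InformationTheory

section

variable {α β : Type*} {mα : MeasurableSpace α} {mβ : MeasurableSpace β}

/-- The swap is an involution, so the data processing inequality holds in both directions. -/
theorem klDiv_map_swap (μ ν : Measure (α × β)) [IsFiniteMeasure μ] [IsFiniteMeasure ν] :
    klDiv (μ.map Prod.swap) (ν.map Prod.swap) = klDiv μ ν := by
  refine le_antisymm (klDiv_map_le μ ν measurable_swap) ?_
  have h := klDiv_map_le (μ.map Prod.swap) (ν.map Prod.swap) (g := Prod.swap) measurable_swap
  rwa [Measure.map_map measurable_swap measurable_swap,
    Measure.map_map measurable_swap measurable_swap, Prod.swap_swap_eq, Measure.map_id,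
    Measure.map_id] at h

/-- The Kullback–Leibler divergence of product probability measures is additive. -/
theorem klDiv_prod_prod (μ ν : Measure α) (μ' ν' : Measure β) [IsProbabilityMeasure μ]
    [IsProbabilityMeasure ν] [IsProbabilityMeasure μ'] [IsProbabilityMeasure ν'] :
    klDiv (μ.prod μ') (ν.prod ν') = klDiv μ ν + klDiv μ' ν' := by
  rw [← Measure.compProd_const, ← Measure.compProd_const, klDiv_compProd_eq_add]
  congr 1
  -- The second term of the chain rule compares μ × μ' with μ × ν'. After the swap the common factor
  -- μ is the kernel, and a common kernel drops out.
  rw [Measure.compProd_const, Measure.compProd_const, ← klDiv_map_swap, Measure.prod_swap,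
    Measure.prod_swap, ← Measure.compProd_const, ← Measure.compProd_const, klDiv_compProd_left]

variable {q π : Measure α} [IsProbabilityMeasure q] [IsProbabilityMeasure π] {f : α → ℝ}

/-- A nonnegative function with an exponential moment under `π` is integrable under every `q` of
finite divergence from `π`. -/
theorem integrable_of_klDiv_ne_top (hkl : klDiv q π ≠ ⊤) (hf0 : ∀ᵐ x ∂π, 0 ≤ f x)
    (hfm : AEMeasurable f π) (hexp : Integrable (fun x => Real.exp (f x)) π) :
    Integrable f q := by
  obtain ⟨hac, hint⟩ := klDiv_ne_top_iff.1 hkl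
  rw [← integrable_rnDeriv_smul_iff hac]
  have hlog := (integrable_rnDeriv_mul_log_iff hac).2 hint
  have hsum := (hlog.sub (Measure.integrable_toReal_rnDeriv (μ := q) (ν := π))).add hexp
  refine hsum.mono' ((q.measurable_rnDeriv π).ennreal_toReal.aestronglyMeasurable.smul
    hfm.aestronglyMeasurable) ?_
  filter_upwards [hf0] with x hx
  set r := (q.rnDeriv π x).toReal with hr
  have hr0 : 0 ≤ r := ENNReal.toReal_nonneg
  simp only [smul_eq_mul, Pi.add_apply, Pi.sub_apply]
  rw [← hr, Real.norm_of_nonneg (mul_nonneg hr0 hx)]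
  rcases hr0.eq_or_lt with h | h
  · rw [← h]; simp [(Real.exp_pos (f x)).le]
  -- Multiplied by r, this is Young's inequality r f ≤ r log r - r + e^f, whose right side is
  -- π-integrable.
  · have h1 := Real.add_one_le_exp (f x - Real.log r)
    rw [Real.exp_sub, Real.exp_log h, le_div_iff₀ h] at h1
    nlinarith

/-- Gibbs' variational identity. -/
theorem integral_sub_toReal_klDiv (hkl : klDiv q π ≠ ⊤) (hf : Integrable f q)
    (hexp : Integrable (fun x => Real.exp (f x)) π) :
    klDiv q (π.tilted f) ≠ ⊤ ∧
      ∫ x, f x ∂q - (klDiv q π).toReal =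
        Real.log (∫ x, Real.exp (f x) ∂π) - (klDiv q (π.tilted f)).toReal := by
  obtain ⟨hac, hint⟩ := klDiv_ne_top_iff.1 hkl
  have := isProbabilityMeasure_tilted hexp
  have hac' : q ≪ π.tilted f := hac.trans (absolutelyContinuous_tilted hexp)
  have hint' := integrable_llr_tilted_right hac hf hint hexp
  refine ⟨klDiv_ne_top hac' hint', ?_⟩
  rw [toReal_klDiv_of_measure_eq hac (by simp), toReal_klDiv_of_measure_eq hac' (by simp),
    integral_llr_tilted_right hac hf hexp hint]
  ring

theorem integral_sub_toReal_klDiv_le (hkl : klDiv q π ≠ ⊤) (hf : Integrable f q)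
    (hexp : Integrable (fun x => Real.exp (f x)) π) :
    ∫ x, f x ∂q - (klDiv q π).toReal ≤ Real.log (∫ x, Real.exp (f x) ∂π) := by
  rw [(integral_sub_toReal_klDiv hkl hf hexp).2]
  linarith [ENNReal.toReal_nonneg (a := klDiv q (π.tilted f))]

theorem eq_tilted_of_integral_sub_toReal_klDiv (hkl : klDiv q π ≠ ⊤) (hf : Integrable f q)
    (hexp : Integrable (fun x => Real.exp (f x)) π)
    (h : ∫ x, f x ∂q - (klDiv q π).toReal = Real.log (∫ x, Real.exp (f x) ∂π)) :
    q = π.tilted f := by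
  have h1 := integral_sub_toReal_klDiv hkl hf hexp
  have := isProbabilityMeasure_tilted hexp
  have h2 : (klDiv q (π.tilted f)).toReal = 0 := by linarith [h1.2]
  -- `toReal` also sends ⊤ to 0, so the finiteness `h1.1` is needed before the divergence can be
  -- called zero.
  rw [ENNReal.toReal_eq_zero_iff] at h2
  exact klDiv_eq_zero_iff.1 (h2.resolve_right h1.1)

/-- The log-density of the tilt is f minus the log of the normalizing constant. This shows that the
maximum is attained and yields the closed-form divergences. -/
theorem klDiv_tilted_self (hexp : Integrable (fun x => Real.exp (f x)) π)
    (hf : Integrable f (π.tilted f)) :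
    klDiv (π.tilted f) π ≠ ⊤ ∧
      (klDiv (π.tilted f) π).toReal =
        ∫ x, f x ∂(π.tilted f) - Real.log (∫ x, Real.exp (f x) ∂π) := by
  have := isProbabilityMeasure_tilted hexp
  have hac := tilted_absolutelyContinuous π f
  have hllr : llr (π.tilted f) π =ᵐ[π.tilted f]
      fun x => f x - Real.log (∫ x, Real.exp (f x) ∂π) :=
    hac.ae_le (log_rnDeriv_tilted_left_self hexp)
  have hint : Integrable (llr (π.tilted f) π) (π.tilted f) :=
    (integrable_congr hllr).2 (hf.sub (integrable_const _))
  refine ⟨klDiv_ne_top hac hint, ?_⟩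
  rw [toReal_klDiv_of_measure_eq hac (by simp), integral_congr_ae hllr,
    integral_sub hf (integrable_const _)]
  simp

/-- A functional of the form `q ↦ ∫ f dq - KL(q ‖ π)`, up to a constant, is uniquely maximized by
the tilted measure. -/
theorem le_tilted_of_eq_integral_sub_klDiv {J : Measure α → EReal} {D : ℝ}
    (hexp : Integrable (fun x => Real.exp (f x)) π) (hfT : Integrable f (π.tilted f))
    (hfq : klDiv q π ≠ ⊤ → Integrable f q) (hbot : klDiv q π = ⊤ → J q = ⊥)
    (hJ : ∀ q : Measure α, IsProbabilityMeasure q → klDiv q π ≠ ⊤ →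
      J q = ((∫ x, f x ∂q - (klDiv q π).toReal - D : ℝ) : EReal)) :
    J q ≤ J (π.tilted f) ∧ (J q = J (π.tilted f) → q = π.tilted f) := by
  have hT := isProbabilityMeasure_tilted hexp
  obtain ⟨hk, hv⟩ := klDiv_tilted_self hexp hfT
  have hJT : J (π.tilted f) = ((Real.log (∫ x, Real.exp (f x) ∂π) - D : ℝ) : EReal) := by
    rw [hJ _ hT hk, hv]
    congr 1
    ring
  rw [hJT]
  by_cases hq : klDiv q π = ⊤
  · rw [hbot hq]
    exact ⟨bot_le, fun h => absurd h.symm (EReal.coe_ne_bot _)⟩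
  · rw [hJ q inferInstance hq, EReal.coe_le_coe_iff, EReal.coe_eq_coe_iff]
    refine ⟨by linarith [integral_sub_toReal_klDiv_le hq (hfq hq) hexp], fun h => ?_⟩
    exact eq_tilted_of_integral_sub_toReal_klDiv hq (hfq hq) hexp (by linarith)

end

end InformationTheory

/-! ### Tilts of product and Gaussian measures -/

namespace MeasureTheory

/-- The tilt of a product measure by a sum of functions of the coordinates. -/
theorem Measure.pi_tilted {ι : Type*} [Fintype ι] {X : ι → Type*} {mX : ∀ i, MeasurableSpace (X i)}
    (P : ∀ i, Measure (X i)) [∀ i, IsProbabilityMeasure (P i)] (f : ∀ i, X i → ℝ)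
    (hexp : ∀ i, Integrable (fun x => Real.exp (f i x)) (P i)) :
    (Measure.pi P).tilted (fun x => ∑ i, f i (x i)) = Measure.pi fun i => (P i).tilted (f i) := by
  have := fun i => isProbabilityMeasure_tilted (hexp i)
  refine (Measure.pi_eq fun s hs => ?_).symm
  have hZ : ∫ x, Real.exp (∑ i, f i (x i)) ∂(Measure.pi P) =
      ∏ i, ∫ x, Real.exp (f i x) ∂(P i) := by
    simp_rw [Real.exp_sum]
    exact integral_fintype_prod_eq_prod (fun i x => Real.exp (f i x))
  rw [tilted_apply_eq_ofReal_integral' _ (MeasurableSet.univ_pi hs), hZ]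
  simp_rw [fun i => tilted_apply_eq_ofReal_integral' (μ := P i) (f i) (hs i)]
  rw [← ENNReal.ofReal_prod_of_nonneg]
  · congr 1
    rw [← integral_indicator (μ := Measure.pi P) (MeasurableSet.univ_pi hs),
      Finset.prod_congr rfl fun i _ => (integral_indicator (μ := P i)
        (f := fun x => Real.exp (f i x) / ∫ x, Real.exp (f i x) ∂(P i)) (hs i)).symm,
      ← integral_fintype_prod_eq_prod (fun i => (s i).indicator
        fun x => Real.exp (f i x) / ∫ x, Real.exp (f i x) ∂(P i))]
    refine integral_congr_ae (ae_of_all _ fun x => ?_)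
    simp only [Real.exp_sum, ← Finset.prod_div_distrib]
    by_cases hx : x ∈ Set.pi univ s
    · rw [indicator_of_mem hx]
      exact Finset.prod_congr rfl fun i _ => by rw [indicator_of_mem (hx i trivial)]
    · rw [indicator_of_notMem hx]
      have : ∃ i, x i ∉ s i := by simpa [Set.mem_pi] using hx
      obtain ⟨i, hi⟩ := this
      exact (Finset.prod_eq_zero (Finset.mem_univ i) (indicator_of_notMem hi _)).symm
  · intro i _
    refine integral_nonneg fun x => ?_
    exact div_nonneg (Real.exp_pos _).le (integral_nonneg fun x => (Real.exp_pos _).le)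

end MeasureTheory

namespace ProbabilityTheory

/-- Tilting a Gaussian measure by a quadratic function. -/
theorem gaussianReal_tilted_quadratic {ν μ a b d : ℝ} {v s : ℝ≥0} (hv : v ≠ 0) (hs : s ≠ 0)
    (ha : (s : ℝ)⁻¹ = (v : ℝ)⁻¹ + a) (hb : μ / s = ν / v + b) :
    Integrable (fun θ => Real.exp (-(1 / 2) * θ ^ 2 * a + θ * b + d)) (gaussianReal ν v) ∧
    ∫ θ, Real.exp (-(1 / 2) * θ ^ 2 * a + θ * b + d) ∂(gaussianReal ν v) =
      Real.sqrt (s / v) * Real.exp (d + μ ^ 2 / (2 * s) - ν ^ 2 / (2 * v)) ∧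
    (gaussianReal ν v).tilted (fun θ => -(1 / 2) * θ ^ 2 * a + θ * b + d) = gaussianReal μ s := by
  have hv0 : (0 : ℝ) < v := NNReal.coe_pos.2 (pos_iff_ne_zero.2 hv)
  have hs0 : (0 : ℝ) < s := NNReal.coe_pos.2 (pos_iff_ne_zero.2 hs)
  set Z := Real.sqrt (s / v) * Real.exp (d + μ ^ 2 / (2 * s) - ν ^ 2 / (2 * v)) with hZ
  have hZ0 : 0 < Z := by positivity
  -- Completing the square: `ha` and `hb` match the coefficients of θ² and θ, and Z collects the
  -- constants and the ratio of the normalizations.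
  have key : ∀ θ, gaussianPDFReal ν v θ * Real.exp (-(1 / 2) * θ ^ 2 * a + θ * b + d) =
      Z * gaussianPDFReal μ s θ := by
    intro θ
    have hE : -(θ - ν) ^ 2 / (2 * v) + (-(1 / 2) * θ ^ 2 * a + θ * b + d) =
        (d + μ ^ 2 / (2 * s) - ν ^ 2 / (2 * v)) + -(θ - μ) ^ 2 / (2 * s) := by
      have e1 : a = (s : ℝ)⁻¹ - (v : ℝ)⁻¹ := by linarith
      have e2 : b = μ / s - ν / v := by linarith
      rw [e1, e2]
      field_simp
      ring
    have hS : (Real.sqrt (2 * Real.pi * v))⁻¹ =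
        Real.sqrt (s / v) * (Real.sqrt (2 * Real.pi * s))⁻¹ := by
      rw [← Real.sqrt_inv, ← Real.sqrt_inv, ← Real.sqrt_mul (by positivity)]
      congr 1
      field_simp
    rw [gaussianPDFReal, gaussianPDFReal, hZ, mul_assoc, ← Real.exp_add, hE, Real.exp_add, hS]
    ring
  have keyE : ∀ θ, gaussianPDF ν v θ *
      ENNReal.ofReal (Real.exp (-(1 / 2) * θ ^ 2 * a + θ * b + d)) =
      ENNReal.ofReal Z * gaussianPDF μ s θ := by
    intro θ
    rw [gaussianPDF, gaussianPDF, ← ENNReal.ofReal_mul (gaussianPDFReal_nonneg _ _ _), key,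
      ENNReal.ofReal_mul hZ0.le]
  have hm : Measurable fun θ => Real.exp (-(1 / 2) * θ ^ 2 * a + θ * b + d) := by fun_prop
  have hlint : ∫⁻ θ, ENNReal.ofReal (Real.exp (-(1 / 2) * θ ^ 2 * a + θ * b + d))
      ∂(gaussianReal ν v) = ENNReal.ofReal Z := by
    rw [gaussianReal_of_var_ne_zero _ hv, lintegral_withDensity_eq_lintegral_mul _
      (measurable_gaussianPDF _ _) hm.ennreal_ofReal]
    simp only [Pi.mul_apply, keyE]
    rw [lintegral_const_mul _ (measurable_gaussianPDF _ _), lintegral_gaussianPDF_eq_one _ hs,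
      mul_one]
  have hint : Integrable (fun θ => Real.exp (-(1 / 2) * θ ^ 2 * a + θ * b + d))
      (gaussianReal ν v) := by
    refine ⟨hm.aestronglyMeasurable, ?_⟩
    rw [hasFiniteIntegral_iff_ofReal (ae_of_all _ fun g => (Real.exp_pos _).le), hlint]
    exact ENNReal.ofReal_lt_top
  have hval : ∫ θ, Real.exp (-(1 / 2) * θ ^ 2 * a + θ * b + d) ∂(gaussianReal ν v) = Z := by
    rw [integral_eq_lintegral_of_nonneg_ae (ae_of_all _ fun g => (Real.exp_pos _).le)
      hm.aestronglyMeasurable, hlint, ENNReal.toReal_ofReal hZ0.le]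
  refine ⟨hint, hval, ?_⟩
  rw [Measure.tilted, hval, gaussianReal_of_var_ne_zero _ hv, gaussianReal_of_var_ne_zero _ hs,
    ← withDensity_mul _ (measurable_gaussianPDF _ _) (by fun_prop)]
  congr 1
  ext1 θ
  rw [Pi.mul_apply, gaussianPDF, gaussianPDF, ← ENNReal.ofReal_mul (gaussianPDFReal_nonneg _ _ _),
    ← mul_div_assoc, key, mul_div_cancel_left₀ _ hZ0.ne']

theorem integrable_sq_gaussianReal (μ : ℝ) (s : ℝ≥0) :
    Integrable (fun θ => θ ^ 2) (gaussianReal μ s) :=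
  (memLp_id_gaussianReal 2).integrable_sq

theorem integrable_id_gaussianReal (μ : ℝ) (s : ℝ≥0) :
    Integrable (fun θ : ℝ => θ) (gaussianReal μ s) :=
  (memLp_id_gaussianReal 1).integrable le_rfl

theorem integral_sq_gaussianReal (μ : ℝ) (s : ℝ≥0) :
    ∫ θ, θ ^ 2 ∂(gaussianReal μ s) = μ ^ 2 + s := by
  have h := variance_eq_sub (memLp_id_gaussianReal (μ := μ) (v := s) 2)
  rw [variance_id_gaussianReal] at h
  simp only [Pi.pow_apply, id, integral_id_gaussianReal] at h
  linarith

end ProbabilityTheory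

/-! ### The density and the Pólya–Gamma identity -/

namespace PolyaGamma

theorem pgMeasure_eq_withDensity {b : ℝ} (hb : 0 < b) (c : ℝ) :
    pgMeasure b c = (volume.restrict (Ioi 0)).withDensity
      (fun ω => ENNReal.ofReal (pgDensity b c ω)) := by
  have := isProbabilityMeasure_pgMeasure hb c
  have h : pgMeasure b c = volume.withDensity (fun ω => ENNReal.ofReal (pgDensity b c ω)) := by
    conv_lhs => rw [← Measure.withDensity_rnDeriv_eq (pgMeasure b c) volume
      (pgMeasure_absolutelyContinuous hb c)]
    refine withDensity_congr_ae ?_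
    filter_upwards [Measure.rnDeriv_lt_top (pgMeasure b c) volume] with x hx
    rw [pgDensity, ENNReal.ofReal_toReal hx.ne]
  rw [← restrict_withDensity measurableSet_Ioi, ← h]
  exact (Measure.restrict_eq_self_of_ae_mem (pgMeasure_ae_pos hb c)).symm

theorem measurable_pgDensity (b c : ℝ) : Measurable (pgDensity b c) :=
  (Measure.measurable_rnDeriv _ _).ennreal_toReal

theorem pgDensity_nonneg (b c ω : ℝ) : 0 ≤ pgDensity b c ω := ENNReal.toReal_nonneg

theorem integrableOn_mul_pgDensity {b : ℝ} (hb : 0 < b) (c : ℝ) {g : ℝ → ℝ}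
    (hg : Integrable g (pgMeasure b c)) :
    IntegrableOn (fun ω => g ω * pgDensity b c ω) (Ioi 0) := by
  rw [pgMeasure_eq_withDensity hb c, integrable_withDensity_iff_integrable_smul'
    (measurable_pgDensity b c).ennreal_ofReal (ae_of_all _ fun x => ENNReal.ofReal_lt_top)] at hg
  refine hg.congr (ae_of_all _ fun x => ?_)
  simp only [ENNReal.toReal_ofReal (pgDensity_nonneg b c x), smul_eq_mul, mul_comm]

theorem setIntegral_mul_pgDensity {b : ℝ} (hb : 0 < b) (c : ℝ) (g : ℝ → ℝ) :
    ∫ ω in Ioi 0, g ω * pgDensity b c ω = ∫ ω, g ω ∂(pgMeasure b c) := by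
  conv_rhs => rw [pgMeasure_eq_withDensity hb c, integral_withDensity_eq_integral_toReal_smul
    (measurable_pgDensity b c).ennreal_ofReal (ae_of_all _ fun x => ENNReal.ofReal_lt_top)]
  refine integral_congr_ae (ae_of_all _ fun x => ?_)
  simp only [ENNReal.toReal_ofReal (pgDensity_nonneg b c x), smul_eq_mul, mul_comm]

theorem integrable_exp_neg_mul_sq_pgMeasure {b : ℝ} (hb : 0 < b) (θ : ℝ) :
    Integrable (fun ω => Real.exp (-(ω * θ ^ 2 / 2))) (pgMeasure b 0) := by
  refine (integrable_exp_mul_pgMeasure hb 0 (t := -(θ ^ 2 / 2))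
    (by nlinarith [sq_nonneg θ])).congr (ae_of_all _ fun ω => ?_)
  exact congrArg Real.exp (by ring)

/-- The Pólya–Gamma identity. -/
theorem exp_pow_div_one_add_exp_pow {m : ℕ} (hm : 0 < m) (y : ℕ) (θ : ℝ) :
    Real.exp θ ^ y / (1 + Real.exp θ) ^ m =
      ((2 : ℝ) ^ m)⁻¹ * Real.exp (((y : ℝ) - (m : ℝ) / 2) * θ) *
        ∫ ω, Real.exp (-(ω * θ ^ 2 / 2)) ∂(pgMeasure m 0) := by
  rw [integral_exp_mul_pgMeasure_zero (Nat.cast_pos.2 hm), Real.rpow_neg (Real.cosh_pos _).le,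
    Real.rpow_natCast]
  -- Extracting e^{θ/2} from the denominator produces both the cosh and the shift -m/2 in κ.
  have h1 : 1 + Real.exp θ = 2 * Real.exp (θ / 2) * Real.cosh (θ / 2) := by
    rw [Real.cosh_eq]
    have e1 : Real.exp θ = Real.exp (θ / 2) * Real.exp (θ / 2) := by
      rw [← Real.exp_add]; ring_nf
    have e2 : Real.exp (θ / 2) * Real.exp (-(θ / 2)) = 1 := by
      rw [← Real.exp_add]; simp
    rw [e1]
    linear_combination -e2
  have h2 : Real.exp (((y : ℝ) - (m : ℝ) / 2) * θ) = Real.exp θ ^ y / Real.exp (θ / 2) ^ m := by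
    rw [← Real.exp_nat_mul, ← Real.exp_nat_mul, ← Real.exp_sub]
    ring_nf
  rw [h1, h2, mul_pow, mul_pow]
  have := (Real.cosh_pos (θ / 2)).ne'
  field_simp

end PolyaGamma

namespace MeasureTheory

/-- Bayes' rule divides the measure by its total mass, a tilt divides its density pointwise.
Identifying the two lets the conditional posterior be read off the Gaussian tilt. -/
theorem inv_smul_withDensity_exp_eq_tilted {α : Type*} {mα : MeasurableSpace α} {μ : Measure α}
    [NeZero μ] {f : α → ℝ} (hm : Measurable f) (hf : Integrable (fun x => Real.exp (f x)) μ) :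
    (∫⁻ x, ENNReal.ofReal (Real.exp (f x)) ∂μ)⁻¹ •
      μ.withDensity (fun x => ENNReal.ofReal (Real.exp (f x))) = μ.tilted f := by
  rw [← ofReal_integral_eq_lintegral_ofReal hf (ae_of_all _ fun x => (Real.exp_pos _).le),
    ← withDensity_smul _ (by fun_prop), Measure.tilted]
  congr 1
  ext1 x
  rw [Pi.smul_apply, smul_eq_mul, div_eq_inv_mul, ENNReal.ofReal_mul
    (inv_nonneg.2 (integral_nonneg fun x => (Real.exp_pos _).le)),
    ENNReal.ofReal_inv_of_pos (integral_exp_pos hf)]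

/-- Jensen's inequality for powers with exponent at most one. -/
theorem integral_rpow_le_rpow_integral {α : Type*} {mα : MeasurableSpace α} {μ : Measure α}
    [IsProbabilityMeasure μ] {g : α → ℝ} (hg0 : ∀ x, 0 ≤ g x) (hg : Integrable g μ) {w : ℝ}
    (hw : 0 ≤ w) (hw1 : w ≤ 1) (hgw : Integrable (fun x => g x ^ w) μ) :
    ∫ x, g x ^ w ∂μ ≤ (∫ x, g x ∂μ) ^ w :=
  (Real.concaveOn_rpow hw hw1).le_map_integral
    (Real.continuous_rpow_const hw).continuousOn isClosed_Ici
    (ae_of_all _ fun x => hg0 x) hg hgw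

end MeasureTheory

/-! ### The logistic block: likelihood, conditional posterior, evidence -/

namespace LogisticBlock

variable {ι : Type*} (B : LogisticBlock ι)

theorem natCast_m_pos (t : ι) : (0 : ℝ) < B.m t := Nat.cast_pos.2 (B.m_pos t)

theorem lik_eq_binomial (t : ι) (θ : ℝ) (hw : B.w t = 1)
    (hh : B.h t = ((B.m t).choose (B.y t) : ℝ)) :
    B.lik t θ = (binomial (B.m t) (unitInterval.sigmoid θ)).real {B.y t} := by
  rw [lik, hw, hh, Real.rpow_one, binomial_real_singleton]
  have hs : ((unitInterval.sigmoid θ : unitInterval) : ℝ) = (1 + Real.exp (-θ))⁻¹ := rfl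
  have he := Real.exp_pos θ
  have h1 : (1 + Real.exp (-θ))⁻¹ = Real.exp θ / (1 + Real.exp θ) := by
    rw [Real.exp_neg]
    field_simp
    ring
  have h2 : 1 - Real.exp θ / (1 + Real.exp θ) = 1 / (1 + Real.exp θ) := by
    field_simp
    ring
  obtain ⟨k, hk⟩ := Nat.exists_eq_add_of_le (B.y_le t)
  rw [hs, h1, h2, hk, Nat.add_sub_cancel_left, mul_assoc, div_pow, div_pow, one_pow, pow_add]
  field_simp

theorem integrable_polyaGamma (t : ι) (θ : ℝ) :
    IntegrableOn (fun ω => Real.exp (-(ω * θ ^ 2 / 2)) * pgDensity (B.m t) 0 ω) (Ioi 0) :=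
  integrableOn_mul_pgDensity (B.natCast_m_pos t) 0
    (integrable_exp_neg_mul_sq_pgMeasure (B.natCast_m_pos t) θ)

theorem polyaGamma_identity (t : ι) (θ : ℝ) :
    Real.exp θ ^ B.y t / (1 + Real.exp θ) ^ B.m t =
      ((2 : ℝ) ^ B.m t)⁻¹ * Real.exp (B.kappa t * θ) *
        ∫ ω in Ioi 0, Real.exp (-(ω * θ ^ 2 / 2)) * pgDensity (B.m t) 0 ω := by
  rw [setIntegral_mul_pgDensity (B.natCast_m_pos t) 0 (fun ω => Real.exp (-(ω * θ ^ 2 / 2))),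
    exp_pow_div_one_add_exp_pow (B.m_pos t), kappa]

theorem condLik_pos (t : ι) (θ ω : ℝ) : 0 < B.condLik t θ ω :=
  mul_pos (B.h_pos t) (Real.rpow_pos_of_pos (by positivity) _)

theorem log_condLik (t : ι) (θ ω : ℝ) :
    Real.log (B.condLik t θ ω) = -(1 / 2) * θ ^ 2 * (B.w t * ω) + θ * (B.w t * B.kappa t) +
      (Real.log (B.h t) - B.w t * B.m t * Real.log 2) := by
  rw [condLik, Real.log_mul (B.h_pos t).ne' (Real.rpow_pos_of_pos (by positivity) _).ne',
    Real.log_rpow (by positivity), Real.log_mul (by positivity) (by positivity),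
    Real.log_mul (by positivity) (by positivity), Real.log_inv, Real.log_pow, Real.log_exp,
    Real.log_exp]
  ring

/-- Here the weight is a power outside the integral over ω, whereas in `condLik` it acts inside; the
two evidences differ only through this. -/
theorem lik_eq_integral (t : ι) (θ : ℝ) :
    B.lik t θ = B.h t * (∫ ω, ((2 : ℝ) ^ B.m t)⁻¹ * Real.exp (B.kappa t * θ) *
      Real.exp (-(ω * θ ^ 2 / 2)) ∂(pgMeasure (B.m t) 0)) ^ B.w t := by
  rw [lik, exp_pow_div_one_add_exp_pow (B.m_pos t), integral_const_mul, kappa]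

theorem integrable_condLik (t : ι) (θ : ℝ) :
    Integrable (fun ω => B.condLik t θ ω) (pgMeasure (B.m t) 0) := by
  have hc : -(B.w t * θ ^ 2 / 2) ≤ 2 := by
    have := mul_nonneg (B.w_nonneg t) (sq_nonneg θ)
    linarith
  refine ((integrable_exp_mul_pgMeasure (B.natCast_m_pos t) 0 hc).const_mul (Real.exp
    (θ * (B.w t * B.kappa t) + (Real.log (B.h t) - B.w t * B.m t * Real.log 2)))).congr
    (ae_of_all _ fun ω => ?_)
  simp only
  rw [← Real.exp_log (B.condLik_pos t θ ω), log_condLik, ← Real.exp_add]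
  exact congrArg Real.exp (by ring)

theorem integral_condLik_of_w_eq_one (t : ι) (θ : ℝ) (hw : B.w t = 1) :
    ∫ ω, B.condLik t θ ω ∂(pgMeasure (B.m t) 0) = B.lik t θ := by
  simp only [lik_eq_integral, condLik, hw, Real.rpow_one, integral_const_mul]

theorem integral_condLik_le (t : ι) (θ : ℝ) (hw : B.w t ≤ 1) :
    ∫ ω, B.condLik t θ ω ∂(pgMeasure (B.m t) 0) ≤ B.lik t θ := by
  have := isProbabilityMeasure_pgMeasure (B.natCast_m_pos t) 0
  have hint := B.integrable_condLik t θ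
  rw [lik_eq_integral]
  simp only [condLik] at hint ⊢
  rw [integral_const_mul]
  refine mul_le_mul_of_nonneg_left ?_ (B.h_pos t).le
  refine integral_rpow_le_rpow_integral (fun ω => by positivity)
    ((integrable_exp_neg_mul_sq_pgMeasure (B.natCast_m_pos t) θ).const_mul _) (B.w_nonneg t) hw ?_
  exact (integrable_const_mul_iff (isUnit_iff_ne_zero.2 (B.h_pos t).ne') _).1 hint

theorem lik_pos (t : ι) (θ : ℝ) : 0 < B.lik t θ :=
  mul_pos (B.h_pos t) (Real.rpow_pos_of_pos (by positivity) _)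

theorem lik_le (t : ι) (θ : ℝ) : B.lik t θ ≤ B.h t := by
  refine mul_le_of_le_one_right (B.h_pos t).le (Real.rpow_le_one (by positivity) ?_ (B.w_nonneg t))
  have he := Real.exp_pos θ
  rw [div_le_one (by positivity)]
  calc Real.exp θ ^ B.y t ≤ (1 + Real.exp θ) ^ B.y t := by gcongr; linarith
    _ ≤ _ := pow_le_pow_right₀ (by linarith) (B.y_le t)

theorem measurable_lik (t : ι) : Measurable (B.lik t) := by
  unfold lik
  fun_prop

variable [Fintype ι]

theorem isProbabilityMeasure_pgLaw (c : ι → ℝ) : IsProbabilityMeasure (B.pgLaw c) := by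
  have := fun t => isProbabilityMeasure_pgMeasure (B.natCast_m_pos t) (c t)
  unfold pgLaw
  infer_instance

theorem blockCondLik_pos (θ : ℝ) (ω : ι → ℝ) : 0 < B.blockCondLik θ ω :=
  Finset.prod_pos fun t _ => B.condLik_pos t θ (ω t)

theorem log_blockCondLik (θ : ℝ) (ω : ι → ℝ) :
    Real.log (B.blockCondLik θ ω) =
      -(1 / 2) * θ ^ 2 * ∑ t, B.w t * ω t + θ * ∑ t, B.w t * B.kappa t + B.logConst := by
  rw [blockCondLik, Real.log_prod fun t _ => (B.condLik_pos t θ (ω t)).ne', logConst,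
    Finset.mul_sum, Finset.mul_sum, ← Finset.sum_add_distrib, ← Finset.sum_add_distrib]
  exact Finset.sum_congr rfl fun t _ => B.log_condLik t θ (ω t)

theorem blockCondLik_eq_exp (θ : ℝ) (ω : ι → ℝ) :
    B.blockCondLik θ ω = Real.exp
      (-(1 / 2) * θ ^ 2 * ∑ t, B.w t * ω t + θ * ∑ t, B.w t * B.kappa t + B.logConst) := by
  rw [← log_blockCondLik, Real.exp_log (B.blockCondLik_pos θ ω)]

theorem pgLaw_map_eval (c : ι → ℝ) (t : ι) :
    MeasurePreserving (fun ω : ι → ℝ => ω t) (B.pgLaw c) (pgMeasure (B.m t) (c t)) := by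
  have := fun t => isProbabilityMeasure_pgMeasure (B.natCast_m_pos t) (c t)
  exact measurePreserving_eval _ t

theorem pgLaw_ae_pos (c : ι → ℝ) : ∀ᵐ ω ∂(B.pgLaw c), ∀ t, 0 < ω t := by
  rw [ae_all_iff]
  intro t
  exact (B.pgLaw_map_eval c t).quasiMeasurePreserving.ae
    (pgMeasure_ae_pos (B.natCast_m_pos t) (c t))

theorem integrable_eval_pgLaw (c : ι → ℝ) (t : ι) :
    Integrable (fun ω : ι → ℝ => ω t) (B.pgLaw c) :=
  (B.pgLaw_map_eval c t).integrable_comp_of_integrable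
    (integrable_id_pgMeasure (B.natCast_m_pos t) (c t))

theorem integral_eval_pgLaw (c : ι → ℝ) (t : ι) :
    ∫ ω, ω t ∂(B.pgLaw c) = pgMean (B.m t) (c t) := by
  rw [← integral_id_pgMeasure (B.natCast_m_pos t) (c t), ← (B.pgLaw_map_eval c t).map_eq,
    integral_map (measurable_pi_apply t).aemeasurable (by fun_prop)]

theorem integrable_exp_eval_pgLaw (c : ι → ℝ) (t : ι) :
    Integrable (fun ω : ι → ℝ => Real.exp (ω t)) (B.pgLaw c) :=
  (B.pgLaw_map_eval c t).integrable_comp_of_integrable (g := Real.exp) (by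
    simpa using integrable_exp_mul_pgMeasure (B.natCast_m_pos t) (c t) (t := 1) (by norm_num))

/-- Exponential tilting of the Pólya–Gamma prior. -/
theorem pgLaw_zero_tilted (c : ι → ℝ) :
    Integrable (fun ω : ι → ℝ => Real.exp (∑ t, -(c t ^ 2 / 2) * ω t)) (B.pgLaw 0) ∧
    Real.log (∫ ω, Real.exp (∑ t, -(c t ^ 2 / 2) * ω t) ∂(B.pgLaw 0)) =
      -∑ t, B.m t * Real.log (Real.cosh (c t / 2)) ∧
    (B.pgLaw 0).tilted (fun ω => ∑ t, -(c t ^ 2 / 2) * ω t) = B.pgLaw c := by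
  have := fun t => isProbabilityMeasure_pgMeasure (B.natCast_m_pos t) 0
  have hexp : ∀ t, Integrable (fun x => Real.exp (-(c t ^ 2 / 2) * x)) (pgMeasure (B.m t) 0) :=
    fun t => integrable_exp_mul_pgMeasure (B.natCast_m_pos t) 0 (by nlinarith [sq_nonneg (c t)])
  refine ⟨?_, ?_, ?_⟩
  · simp_rw [Real.exp_sum]
    exact Integrable.fintype_prod_dep (f := fun t x => Real.exp (-(c t ^ 2 / 2) * x)) hexp
  · have hval : ∫ ω, Real.exp (∑ t, -(c t ^ 2 / 2) * ω t) ∂(B.pgLaw 0) =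
        ∏ t, Real.cosh (c t / 2) ^ (-(B.m t : ℝ)) := by
      simp_rw [Real.exp_sum]
      refine (integral_fintype_prod_eq_prod (μ := fun t => pgMeasure (B.m t) 0)
        (fun t x => Real.exp (-(c t ^ 2 / 2) * x))).trans (Finset.prod_congr rfl fun t _ => ?_)
      rw [← integral_exp_mul_pgMeasure_zero (B.natCast_m_pos t)]
      refine integral_congr_ae (ae_of_all _ fun x => ?_)
      exact congrArg Real.exp (by ring)
    rw [hval, Real.log_prod fun t _ => (Real.rpow_pos_of_pos (Real.cosh_pos _) _).ne',
      ← Finset.sum_neg_distrib]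
    refine Finset.sum_congr rfl fun t _ => ?_
    rw [Real.log_rpow (Real.cosh_pos _)]
    ring
  · refine (Measure.pi_tilted (fun t => pgMeasure (B.m t) 0) (fun t x => -(c t ^ 2 / 2) * x)
      hexp).trans ?_
    simp_rw [fun t => tilted_pgMeasure_zero (B.natCast_m_pos t) (c t)]
    rfl

/-- Tilting the prior of `θ` by the quadratic log-likelihood gives the Gaussian update. -/
theorem gaussianReal_tilted_eq_gaussUpdate (ν : ℝ) {ρ : ℝ≥0} (hρ : 0 < ρ) (e : ι → ℝ)
    (he : 0 < B.gaussPrec ρ e) :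
    Integrable (fun θ => Real.exp (-(1 / 2) * θ ^ 2 * ∑ t, B.w t * e t +
      θ * ∑ t, B.w t * B.kappa t + B.logConst)) (gaussianReal ν (ρ ^ 2)) ∧
    (gaussianReal ν (ρ ^ 2)).tilted (fun θ => -(1 / 2) * θ ^ 2 * ∑ t, B.w t * e t +
      θ * ∑ t, B.w t * B.kappa t + B.logConst) = B.gaussUpdate ν ρ e := by
  have hs : (((B.gaussPrec ρ e)⁻¹.toNNReal : ℝ≥0) : ℝ) = (B.gaussPrec ρ e)⁻¹ :=
    Real.coe_toNNReal _ (inv_pos.2 he).le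
  have h := gaussianReal_tilted_quadratic (ν := ν)
    (μ := (B.gaussPrec ρ e)⁻¹ * (((ρ : ℝ) ^ 2)⁻¹ * ν + ∑ t, B.w t * B.kappa t))
    (a := ∑ t, B.w t * e t) (b := ∑ t, B.w t * B.kappa t) (d := B.logConst) (v := ρ ^ 2)
    (s := (B.gaussPrec ρ e)⁻¹.toNNReal) (by positivity)
    (by simpa using he) (by rw [hs, inv_inv]; simp [gaussPrec])
    (by
      rw [hs, div_inv_eq_mul, mul_comm, mul_inv_cancel_left₀ he.ne']
      push_cast
      ring)
  exact ⟨h.1, h.2.2⟩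

theorem gaussPrec_pos {ρ : ℝ≥0} (hρ : 0 < ρ) {e : ι → ℝ} (he : ∀ t, 0 ≤ e t) :
    0 < B.gaussPrec ρ e :=
  add_pos_of_pos_of_nonneg (by positivity)
    (Finset.sum_nonneg fun t _ => mul_nonneg (B.w_nonneg t) (he t))

theorem condPosterior_eq (ν : ℝ) {ρ : ℝ≥0} (hρ : 0 < ρ) {ω : ι → ℝ} (hω : ∀ t, 0 < ω t) :
    B.condPosterior ν ρ ω = B.gaussUpdate ν ρ ω := by
  obtain ⟨h1, h2⟩ := B.gaussianReal_tilted_eq_gaussUpdate ν hρ ω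
    (B.gaussPrec_pos hρ fun t => (hω t).le)
  rw [← h2, condPosterior]
  simp only [blockCondLik_eq_exp]
  exact inv_smul_withDensity_exp_eq_tilted (by fun_prop) h1

theorem continuous_blockCondLik :
    Continuous fun z : ℝ × (ι → ℝ) => B.blockCondLik z.1 z.2 := by
  simp_rw [blockCondLik_eq_exp]
  fun_prop

theorem isProbabilityMeasure_jointPrior (ν : ℝ) (ρ : ℝ≥0) :
    IsProbabilityMeasure (B.jointPrior ν ρ) := by
  have := B.isProbabilityMeasure_pgLaw 0
  unfold jointPrior
  infer_instance

/-- Almost surely ω ≥ 0, so the quadratic term only decreases the likelihood; what remains is an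
exponential of a linear function of θ, integrable under a Gaussian. -/
theorem integrable_blockCondLik (ν : ℝ) (ρ : ℝ≥0) :
    Integrable (fun z : ℝ × (ι → ℝ) => B.blockCondLik z.1 z.2) (B.jointPrior ν ρ) := by
  have := B.isProbabilityMeasure_pgLaw 0
  have h1 : Integrable (fun θ => Real.exp B.logConst *
      Real.exp ((∑ t, B.w t * B.kappa t) * θ)) (gaussianReal ν (ρ ^ 2)) :=
    (integrable_exp_mul_gaussianReal _).const_mul _
  refine (h1.comp_fst (B.pgLaw 0)).mono' B.continuous_blockCondLik.aestronglyMeasurable ?_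
  have h2 : ∀ᵐ z ∂(B.jointPrior ν ρ), ∀ t, 0 < z.2 t :=
    Measure.quasiMeasurePreserving_snd.ae (B.pgLaw_ae_pos 0)
  filter_upwards [h2] with z hz
  rw [Real.norm_of_nonneg (B.blockCondLik_pos _ _).le, blockCondLik_eq_exp, ← Real.exp_add,
    Real.exp_le_exp]
  have : 0 ≤ z.1 ^ 2 * ∑ t, B.w t * z.2 t :=
    mul_nonneg (sq_nonneg _) (Finset.sum_nonneg fun t _ => mul_nonneg (B.w_nonneg t) (hz t).le)
  nlinarith

theorem augEvidence_pos (ν : ℝ) (ρ : ℝ≥0) : 0 < B.augEvidence ν ρ := by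
  have := B.isProbabilityMeasure_jointPrior ν ρ
  have h := B.integrable_blockCondLik ν ρ
  unfold augEvidence
  simp only [blockCondLik_eq_exp] at h ⊢
  exact integral_exp_pos h

theorem augEvidence_eq_integral (ν : ℝ) (ρ : ℝ≥0) :
    B.augEvidence ν ρ = ∫ θ, ∏ t, ∫ ω, B.condLik t θ ω ∂(pgMeasure (B.m t) 0)
      ∂(gaussianReal ν (ρ ^ 2)) := by
  have := fun t => isProbabilityMeasure_pgMeasure (B.natCast_m_pos t) 0
  have := B.isProbabilityMeasure_pgLaw 0
  have h := B.integrable_blockCondLik ν ρ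
  unfold augEvidence jointPrior at *
  rw [integral_prod _ h]
  refine integral_congr_ae (ae_of_all _ fun θ => ?_)
  exact integral_fintype_prod_eq_prod (μ := fun t => pgMeasure (B.m t) 0)
    (fun t ω => B.condLik t θ ω)

theorem augEvidence_eq_evidence (ν : ℝ) (ρ : ℝ≥0) (hw : ∀ t, B.w t = 1) :
    B.augEvidence ν ρ = B.evidence ν ρ := by
  rw [augEvidence_eq_integral, evidence]
  simp only [B.integral_condLik_of_w_eq_one _ _ (hw _), blockLik]

theorem augEvidence_le_evidence (ν : ℝ) (ρ : ℝ≥0) (hw : ∀ t, B.w t ≤ 1) :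
    B.augEvidence ν ρ ≤ B.evidence ν ρ := by
  rw [augEvidence_eq_integral, evidence]
  refine integral_mono_of_nonneg (ae_of_all _ fun θ => ?_) ?_ (ae_of_all _ fun θ => ?_)
  · exact Finset.prod_nonneg fun t _ => integral_nonneg fun ω => (B.condLik_pos t θ ω).le
  · refine Integrable.of_bound (C := ∏ t, B.h t)
      (Finset.measurable_fun_prod _ fun t _ => B.measurable_lik t).aestronglyMeasurable
      (ae_of_all _ fun θ => ?_)
    rw [blockLik, Real.norm_of_nonneg (Finset.prod_nonneg fun t _ => (B.lik_pos t θ).le)]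
    exact Finset.prod_le_prod (fun t _ => (B.lik_pos t θ).le) fun t _ => B.lik_le t θ
  · exact Finset.prod_le_prod
      (fun t _ => integral_nonneg fun ω => (B.condLik_pos t θ ω).le)
      fun t _ => B.integral_condLik_le t θ (hw t)

end LogisticBlock

/-! ### The variational objective and its coordinate maximizers -/

namespace LogisticBlock

open InformationTheory

variable {ι : Type*} [Fintype ι] (B : LogisticBlock ι)

theorem integrable_exp_mul_sq_gaussianReal (ν : ℝ) {ρ : ℝ≥0} (hρ : 0 < ρ) :
    Integrable (fun θ => Real.exp (1 / (4 * (ρ : ℝ) ^ 2) * θ ^ 2)) (gaussianReal ν (ρ ^ 2)) := by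
  have hρ' : (0 : ℝ) < ρ := hρ
  -- The coefficient 1/(4ρ²) is half the critical 1/(2ρ²), so the tilt doubles the variance; the
  -- linear condition then forces mean 2ν.
  have h := (gaussianReal_tilted_quadratic (ν := ν) (μ := 2 * ν)
    (a := -(1 / (2 * (ρ : ℝ) ^ 2))) (b := 0) (d := 0) (v := ρ ^ 2)
    (s := 2 * ρ ^ 2) (by positivity) (by positivity)
    (by push_cast; field_simp; norm_num)
    (by push_cast; field_simp; norm_num)).1
  refine h.congr (ae_of_all _ fun θ => ?_)
  refine congrArg Real.exp ?_
  field_simp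
  ring

section

variable {ν : ℝ} {ρ : ℝ≥0} {qθ : Measure ℝ} {qω : Measure (ι → ℝ)}

theorem integrable_sq_of_klDiv_ne_top [IsProbabilityMeasure qθ] (hρ : 0 < ρ)
    (h : klDiv qθ (gaussianReal ν (ρ ^ 2)) ≠ ⊤) : Integrable (fun θ => θ ^ 2) qθ := by
  have hρ' : (0 : ℝ) < ρ := hρ
  have h1 := integrable_of_klDiv_ne_top h (ae_of_all _ fun θ => by positivity)
    (Measurable.aemeasurable (by fun_prop)) (integrable_exp_mul_sq_gaussianReal ν hρ)
  exact (integrable_const_mul_iff (isUnit_iff_ne_zero.2 (by positivity)) _).1 h1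

theorem integrable_id_of_klDiv_ne_top [IsProbabilityMeasure qθ] (hρ : 0 < ρ)
    (h : klDiv qθ (gaussianReal ν (ρ ^ 2)) ≠ ⊤) : Integrable (fun θ : ℝ => θ) qθ := by
  refine ((integrable_const (1 : ℝ)).add (integrable_sq_of_klDiv_ne_top hρ h)).mono'
    (by fun_prop) (ae_of_all _ fun θ => ?_)
  simp only [Pi.add_apply, Real.norm_eq_abs]
  nlinarith [sq_abs θ, sq_nonneg (|θ| - 1), abs_nonneg θ]

theorem integrable_eval_of_klDiv_ne_top [IsProbabilityMeasure qω]
    (h : klDiv qω (B.pgLaw 0) ≠ ⊤) (t : ι) : Integrable (fun ω : ι → ℝ => ω t) qω := by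
  have := B.isProbabilityMeasure_pgLaw 0
  exact integrable_of_klDiv_ne_top h ((B.pgLaw_ae_pos 0).mono fun ω hω => (hω t).le)
    (measurable_pi_apply t).aemeasurable (B.integrable_exp_eval_pgLaw 0 t)

theorem integral_eval_nonneg_of_klDiv_ne_top
    (h : klDiv qω (B.pgLaw 0) ≠ ⊤) (t : ι) : 0 ≤ ∫ ω, ω t ∂qω :=
  integral_nonneg_of_ae ((klDiv_ne_top_iff.1 h).1.ae_le
    ((B.pgLaw_ae_pos 0).mono fun _ hω => (hω t).le))

theorem klDiv_jointPrior [IsProbabilityMeasure qθ] [IsProbabilityMeasure qω] :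
    klDiv (qθ.prod qω) (B.jointPrior ν ρ) =
      klDiv qθ (gaussianReal ν (ρ ^ 2)) + klDiv qω (B.pgLaw 0) := by
  have := B.isProbabilityMeasure_pgLaw 0
  exact klDiv_prod_prod _ _ _ _

/-- The only term mixing the variables is the product θ² ω_t, whose expectation factors by
independence. The objective thus sees the two laws only through these moments and their divergences.
-/
theorem integrable_log_blockCondLik [IsProbabilityMeasure qθ] [IsProbabilityMeasure qω]
    (h2 : Integrable (fun θ => θ ^ 2) qθ) (h1 : Integrable (fun θ : ℝ => θ) qθ)
    (hω : ∀ t, Integrable (fun ω : ι → ℝ => ω t) qω) :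
    Integrable (fun z : ℝ × (ι → ℝ) => Real.log (B.blockCondLik z.1 z.2)) (qθ.prod qω) ∧
    ∫ z, Real.log (B.blockCondLik z.1 z.2) ∂(qθ.prod qω) =
      -(1 / 2) * (∫ θ, θ ^ 2 ∂qθ) * ∑ t, B.w t * ∫ ω, ω t ∂qω +
        (∫ θ, θ ∂qθ) * ∑ t, B.w t * B.kappa t + B.logConst := by
  simp only [log_blockCondLik]
  have hW : Integrable (fun ω : ι → ℝ => ∑ t, B.w t * ω t) qω :=
    integrable_finsetSum _ fun t _ => (hω t).const_mul _
  have hA : Integrable (fun z : ℝ × (ι → ℝ) => -(1 / 2) * z.1 ^ 2 * ∑ t, B.w t * z.2 t)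
      (qθ.prod qω) := (h2.const_mul (-(1 / 2))).mul_prod hW
  have hB : Integrable (fun z : ℝ × (ι → ℝ) => z.1 * ∑ t, B.w t * B.kappa t) (qθ.prod qω) :=
    (h1.mul_const _).comp_fst qω
  have hAB : Integrable (fun z : ℝ × (ι → ℝ) => -(1 / 2) * z.1 ^ 2 * ∑ t, B.w t * z.2 t +
      z.1 * ∑ t, B.w t * B.kappa t) (qθ.prod qω) := hA.add hB
  refine ⟨hAB.add (integrable_const _), ?_⟩
  rw [integral_add hAB (integrable_const _), integral_add hA hB,
    integral_prod_mul (fun θ : ℝ => -(1 / 2) * θ ^ 2) (fun ω : ι → ℝ => ∑ t, B.w t * ω t),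
    integral_fun_fst (fun θ : ℝ => θ * ∑ t, B.w t * B.kappa t), integral_mul_const,
    integral_const_mul, integral_finsetSum _ fun t _ => (hω t).const_mul _]
  simp [integral_const_mul]

theorem elbo_eq_bot (h : klDiv (qθ.prod qω) (B.jointPrior ν ρ) = ⊤) :
    B.elbo ν ρ qθ qω = ⊥ := by
  rw [elbo, h, EReal.coe_ennreal_top, EReal.sub_top]

theorem elbo_eq_coe (h : klDiv (qθ.prod qω) (B.jointPrior ν ρ) ≠ ⊤) :
    B.elbo ν ρ qθ qω = ((∫ z, Real.log (B.blockCondLik z.1 z.2) ∂(qθ.prod qω) -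
      (klDiv (qθ.prod qω) (B.jointPrior ν ρ)).toReal : ℝ) : EReal) := by
  rw [elbo, EReal.coe_sub]
  congr 1
  lift klDiv (qθ.prod qω) (B.jointPrior ν ρ) to ℝ≥0 using h with k
  rfl

theorem integrable_log_blockCondLik_of_klDiv_ne_top [IsProbabilityMeasure qθ]
    [IsProbabilityMeasure qω] (hρ : 0 < ρ) (h : klDiv (qθ.prod qω) (B.jointPrior ν ρ) ≠ ⊤) :
    Integrable (fun z : ℝ × (ι → ℝ) => Real.log (B.blockCondLik z.1 z.2)) (qθ.prod qω) := by
  rw [klDiv_jointPrior, ENNReal.add_ne_top] at h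
  exact (B.integrable_log_blockCondLik (integrable_sq_of_klDiv_ne_top hρ h.1)
    (integrable_id_of_klDiv_ne_top hρ h.1) (B.integrable_eval_of_klDiv_ne_top h.2)).1

/-- The mean-field objective in terms of the moments of the two factors. -/
theorem elbo_eq_of_klDiv_ne_top [IsProbabilityMeasure qθ] [IsProbabilityMeasure qω] (hρ : 0 < ρ)
    (hθ : klDiv qθ (gaussianReal ν (ρ ^ 2)) ≠ ⊤) (hω : klDiv qω (B.pgLaw 0) ≠ ⊤) :
    B.elbo ν ρ qθ qω =
      ((-(1 / 2) * (∫ θ, θ ^ 2 ∂qθ) * ∑ t, B.w t * ∫ ω, ω t ∂qω +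
        (∫ θ, θ ∂qθ) * ∑ t, B.w t * B.kappa t + B.logConst -
        (klDiv qθ (gaussianReal ν (ρ ^ 2))).toReal - (klDiv qω (B.pgLaw 0)).toReal : ℝ) :
          EReal) := by
  have h : klDiv (qθ.prod qω) (B.jointPrior ν ρ) ≠ ⊤ := by
    rw [klDiv_jointPrior]
    exact ENNReal.add_ne_top.2 ⟨hθ, hω⟩
  rw [elbo_eq_coe _ h, klDiv_jointPrior, ENNReal.toReal_add hθ hω,
    (B.integrable_log_blockCondLik (integrable_sq_of_klDiv_ne_top hρ hθ)
    (integrable_id_of_klDiv_ne_top hρ hθ) (B.integrable_eval_of_klDiv_ne_top hω)).2]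
  congr 1
  ring

/-- Gibbs' inequality under the joint prior with f = log p(y ∣ θ, ω), for which ∫ e^f is the
augmented evidence. -/
theorem elbo_le_log_augEvidence [IsProbabilityMeasure qθ] [IsProbabilityMeasure qω]
    (hρ : 0 < ρ) : B.elbo ν ρ qθ qω ≤ ((Real.log (B.augEvidence ν ρ) : ℝ) : EReal) := by
  by_cases h : klDiv (qθ.prod qω) (B.jointPrior ν ρ) = ⊤
  · rw [elbo_eq_bot _ h]
    exact bot_le
  have := B.isProbabilityMeasure_jointPrior ν ρ
  have he : ∀ z : ℝ × (ι → ℝ), Real.exp (Real.log (B.blockCondLik z.1 z.2)) =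
      B.blockCondLik z.1 z.2 := fun z => Real.exp_log (B.blockCondLik_pos _ _)
  rw [elbo_eq_coe _ h, EReal.coe_le_coe_iff]
  have h1 := integral_sub_toReal_klDiv_le h
    (B.integrable_log_blockCondLik_of_klDiv_ne_top hρ h)
    (by simp only [he]; exact B.integrable_blockCondLik ν ρ)
  simp only [he] at h1
  exact h1

theorem integrable_quadratic {a b d : ℝ} [IsProbabilityMeasure qθ]
    (h2 : Integrable (fun θ => θ ^ 2) qθ) (h1 : Integrable (fun θ : ℝ => θ) qθ) :
    Integrable (fun θ => -(1 / 2) * θ ^ 2 * a + θ * b + d) qθ ∧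
    ∫ θ, -(1 / 2) * θ ^ 2 * a + θ * b + d ∂qθ =
      -(1 / 2) * (∫ θ, θ ^ 2 ∂qθ) * a + (∫ θ, θ ∂qθ) * b + d := by
  have hA := (h2.const_mul (-(1 / 2))).mul_const a
  have hB := h1.mul_const b
  have hAB : Integrable (fun θ => -(1 / 2) * θ ^ 2 * a + θ * b) qθ := hA.add hB
  refine ⟨hAB.add (integrable_const _), ?_⟩
  rw [integral_add hAB (integrable_const _), integral_add hA hB, integral_mul_const,
    integral_const_mul, integral_mul_const]
  simp

/-- The optimal `q(θ)` is the Gaussian update. -/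
theorem elbo_le_gaussUpdate [IsProbabilityMeasure qθ] [IsProbabilityMeasure qω] (hρ : 0 < ρ)
    (hω : klDiv qω (B.pgLaw 0) ≠ ⊤) :
    B.elbo ν ρ qθ qω ≤ B.elbo ν ρ (B.gaussUpdate ν ρ (fun t => ∫ ω, ω t ∂qω)) qω ∧
    (B.elbo ν ρ qθ qω = B.elbo ν ρ (B.gaussUpdate ν ρ (fun t => ∫ ω, ω t ∂qω)) qω →
      qθ = B.gaussUpdate ν ρ (fun t => ∫ ω, ω t ∂qω)) := by
  obtain ⟨hexp, hT⟩ := B.gaussianReal_tilted_eq_gaussUpdate ν hρ (fun t => ∫ ω, ω t ∂qω)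
    (B.gaussPrec_pos hρ (B.integral_eval_nonneg_of_klDiv_ne_top hω))
  rw [← hT]
  -- With `qω` fixed, f is the log-likelihood with each ω_t replaced by its mean, and the divergence
  -- of `qω` is the constant D.
  refine le_tilted_of_eq_integral_sub_klDiv (J := fun q => B.elbo ν ρ q qω)
    (D := (klDiv qω (B.pgLaw 0)).toReal) hexp ?_ ?_ ?_ ?_
  · rw [hT, gaussUpdate]
    exact (integrable_quadratic (integrable_sq_gaussianReal _ _)
      (integrable_id_gaussianReal _ _)).1
  · intro h
    exact (integrable_quadratic (integrable_sq_of_klDiv_ne_top hρ h)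
      (integrable_id_of_klDiv_ne_top hρ h)).1
  · intro h
    refine B.elbo_eq_bot ?_
    rw [klDiv_jointPrior, h, top_add]
  · intro q hq h
    rw [B.elbo_eq_of_klDiv_ne_top hρ h hω, (integrable_quadratic
      (integrable_sq_of_klDiv_ne_top hρ h) (integrable_id_of_klDiv_ne_top hρ h)).2]

theorem integrable_sum_mul_eval (c : ι → ℝ)
    (h : ∀ t, Integrable (fun ω : ι → ℝ => ω t) qω) :
    Integrable (fun ω => ∑ t, c t * ω t) qω ∧
      ∫ ω, ∑ t, c t * ω t ∂qω = ∑ t, c t * ∫ ω, ω t ∂qω := by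
  refine ⟨integrable_finsetSum _ fun t _ => (h t).const_mul _, ?_⟩
  rw [integral_finsetSum _ fun t _ => (h t).const_mul _]
  simp only [integral_const_mul]

/-- The optimal `q(ω)` is a product of Pólya–Gamma laws. -/
theorem elbo_le_pgUpdate [IsProbabilityMeasure qθ] [IsProbabilityMeasure qω] (hρ : 0 < ρ)
    (hθ : klDiv qθ (gaussianReal ν (ρ ^ 2)) ≠ ⊤) :
    B.elbo ν ρ qθ qω ≤ B.elbo ν ρ qθ (B.pgUpdate (∫ θ, θ ^ 2 ∂qθ)) ∧
    (B.elbo ν ρ qθ qω = B.elbo ν ρ qθ (B.pgUpdate (∫ θ, θ ^ 2 ∂qθ)) →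
      qω = B.pgUpdate (∫ θ, θ ^ 2 ∂qθ)) := by
  have := B.isProbabilityMeasure_pgLaw 0
  set s := ∫ θ, θ ^ 2 ∂qθ with hs
  have hs0 : 0 ≤ s := integral_nonneg fun θ => sq_nonneg θ
  have hsq : ∀ t, Real.sqrt (B.w t * s) ^ 2 = B.w t * s := fun t =>
    Real.sq_sqrt (mul_nonneg (B.w_nonneg t) hs0)
  obtain ⟨hexp, -, hT⟩ := B.pgLaw_zero_tilted (fun t => Real.sqrt (B.w t * s))
  rw [pgUpdate, ← hT]
  -- With `qθ` fixed, ω_t has coefficient -w_t E[θ²]/2 = -c_t²/2, which determines c_t; D collects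
  -- all terms free of ω.
  refine le_tilted_of_eq_integral_sub_klDiv (J := fun q => B.elbo ν ρ qθ q)
    (D := (klDiv qθ (gaussianReal ν (ρ ^ 2))).toReal -
      (∫ θ, θ ∂qθ) * ∑ t, B.w t * B.kappa t - B.logConst) hexp ?_ ?_ ?_ ?_
  · rw [hT]
    exact (integrable_sum_mul_eval _ (B.integrable_eval_pgLaw _)).1
  · intro h
    exact (integrable_sum_mul_eval _ (B.integrable_eval_of_klDiv_ne_top h)).1
  · intro h
    refine B.elbo_eq_bot ?_
    rw [klDiv_jointPrior, h, add_top]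
  · intro q hq h
    rw [B.elbo_eq_of_klDiv_ne_top hρ hθ h,
      (integrable_sum_mul_eval _ (B.integrable_eval_of_klDiv_ne_top h)).2, ← hs]
    congr 1
    have : ∑ t, -(Real.sqrt (B.w t * s) ^ 2 / 2) * ∫ ω, ω t ∂q =
        -(1 / 2) * s * ∑ t, B.w t * ∫ ω, ω t ∂q := by
      rw [Finset.mul_sum]
      refine Finset.sum_congr rfl fun t _ => ?_
      rw [hsq]
      ring
    rw [this]
    ring

end

/-- Any nondegenerate Gaussian is a quadratic tilt of any other; a and b are solved from the
matching conditions, and the divergence is that of a tilt. -/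
theorem klDiv_gaussianReal {ν μ : ℝ} {v s : ℝ≥0} (hv : v ≠ 0) (hs : s ≠ 0) :
    klDiv (gaussianReal μ s) (gaussianReal ν v) ≠ ⊤ ∧
    (klDiv (gaussianReal μ s) (gaussianReal ν v)).toReal =
      (Real.log (v / s) + (s + (μ - ν) ^ 2) / v - 1) / 2 := by
  have hv0 : (0 : ℝ) < v := NNReal.coe_pos.2 (pos_iff_ne_zero.2 hv)
  have hs0 : (0 : ℝ) < s := NNReal.coe_pos.2 (pos_iff_ne_zero.2 hs)
  obtain ⟨hexp, hval, hT⟩ := gaussianReal_tilted_quadratic (ν := ν) (μ := μ)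
    (a := (s : ℝ)⁻¹ - (v : ℝ)⁻¹) (b := μ / s - ν / v) (d := 0) hv hs (by ring) (by ring)
  obtain ⟨hi, hv'⟩ := integrable_quadratic (qθ := gaussianReal μ s)
    (a := (s : ℝ)⁻¹ - (v : ℝ)⁻¹) (b := μ / s - ν / v) (d := 0)
    (integrable_sq_gaussianReal _ _) (integrable_id_gaussianReal _ _)
  have h := klDiv_tilted_self hexp (by rw [hT]; exact hi)
  rw [hT, hval, hv'] at h
  refine ⟨h.1, h.2.trans ?_⟩
  rw [integral_sq_gaussianReal, integral_id_gaussianReal, Real.log_mul (by positivity)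
    (Real.exp_pos _).ne', Real.log_exp, Real.log_sqrt (by positivity),
    Real.log_div hs0.ne' hv0.ne', Real.log_div hv0.ne' hs0.ne']
  field_simp
  ring

theorem klDiv_pgLaw (c : ι → ℝ) :
    klDiv (B.pgLaw c) (B.pgLaw 0) ≠ ⊤ ∧
    (klDiv (B.pgLaw c) (B.pgLaw 0)).toReal =
      ∑ t, (B.m t * Real.log (Real.cosh (c t / 2)) - c t ^ 2 / 2 * pgMean (B.m t) (c t)) := by
  have := B.isProbabilityMeasure_pgLaw 0
  obtain ⟨hexp, hval, hT⟩ := B.pgLaw_zero_tilted c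
  obtain ⟨hi, hv⟩ := integrable_sum_mul_eval (fun t => -(c t ^ 2 / 2))
    (B.integrable_eval_pgLaw c)
  have h := klDiv_tilted_self hexp (by rw [hT]; exact hi)
  rw [hT, hval, hv] at h
  refine ⟨h.1, h.2.trans ?_⟩
  simp only [integral_eval_pgLaw]
  rw [sub_neg_eq_add, ← Finset.sum_add_distrib]
  exact Finset.sum_congr rfl fun t _ => by ring

theorem elbo_gaussianReal_pgLaw (ν : ℝ) {ρ : ℝ≥0} (hρ : 0 < ρ) (μ : ℝ) {s : ℝ≥0} (hs : 0 < s)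
    (c : ι → ℝ) :
    B.elbo ν ρ (gaussianReal μ s) (B.pgLaw c) =
      ((B.logConst + μ * ∑ t, B.w t * B.kappa t
        - (μ ^ 2 + s) / 2 * ∑ t, B.w t * pgMean (B.m t) (c t)
        - (Real.log ((ρ : ℝ) ^ 2 / s) + (s + (μ - ν) ^ 2) / (ρ : ℝ) ^ 2 - 1) / 2
        - ∑ t, (B.m t * Real.log (Real.cosh (c t / 2))
            - c t ^ 2 / 2 * pgMean (B.m t) (c t)) : ℝ) : EReal) := by
  have := B.isProbabilityMeasure_pgLaw c
  obtain ⟨hθ, hθ'⟩ := klDiv_gaussianReal (ν := ν) (μ := μ) (v := ρ ^ 2) (s := s)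
    (by positivity) hs.ne'
  obtain ⟨hω, hω'⟩ := B.klDiv_pgLaw c
  rw [B.elbo_eq_of_klDiv_ne_top hρ hθ hω, hθ', hω', integral_sq_gaussianReal,
    integral_id_gaussianReal]
  simp only [integral_eval_pgLaw]
  congr 1
  push_cast
  ring

end LogisticBlock

end

theorem mainTheorem7 {ι : Type*} [Fintype ι] (B : LogisticBlock ι) (ν : ℝ) (ρ : ℝ≥0)
    (hρ : 0 < ρ) :
    -- with unit weights and binomial base measure, this is the binomial model with logit link
    (∀ t θ, B.w t = 1 → B.h t = ((B.m t).choose (B.y t) : ℝ) →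
      B.lik t θ = (binomial (B.m t) (unitInterval.sigmoid θ)).real {B.y t}) ∧
    -- `PG(m_t, 0)` is a probability law on `(0, ∞)` with a Lebesgue density
    (∀ t, IsProbabilityMeasure (PolyaGamma.pgMeasure (B.m t) 0) ∧
      PolyaGamma.pgMeasure (B.m t) 0 = (volume.restrict (Ioi 0)).withDensity
        (fun ω => ENNReal.ofReal (PolyaGamma.pgDensity (B.m t) 0 ω))) ∧
    -- the Pólya–Gamma identity
    (∀ t θ,
      IntegrableOn (fun ω => Real.exp (-(ω * θ ^ 2 / 2)) * PolyaGamma.pgDensity (B.m t) 0 ω)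
        (Ioi 0) ∧
      Real.exp θ ^ B.y t / (1 + Real.exp θ) ^ B.m t =
        ((2 : ℝ) ^ B.m t)⁻¹ * Real.exp (B.kappa t * θ) *
          ∫ ω in Ioi 0, Real.exp (-(ω * θ ^ 2 / 2)) * PolyaGamma.pgDensity (B.m t) 0 ω) ∧
    -- conditionally on `ω`, the block log-likelihood is quadratic in `θ`
    (∀ θ (ω : ι → ℝ),
      0 < B.blockCondLik θ ω ∧
      Real.log (B.blockCondLik θ ω) =
        -(1 / 2) * θ ^ 2 * ∑ t, B.w t * ω t + θ * ∑ t, B.w t * B.kappa t + B.logConst) ∧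
    -- the conditional posterior is Gaussian
    (∀ ω : ι → ℝ, (∀ t, 0 < ω t) → B.condPosterior ν ρ ω = B.gaussUpdate ν ρ ω) ∧
    -- the augmented evidence; it is the block evidence when all weights are `1`
    0 < B.augEvidence ν ρ ∧
    ((∀ t, B.w t = 1) → B.augEvidence ν ρ = B.evidence ν ρ) ∧
    ((∀ t, B.w t ≤ 1) → B.augEvidence ν ρ ≤ B.evidence ν ρ) ∧
    -- the mean-field objective is well defined, and it is a lower bound on the log-evidence
    (∀ (qθ : Measure ℝ) (qω : Measure (ι → ℝ)) [IsProbabilityMeasure qθ]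
        [IsProbabilityMeasure qω],
      (InformationTheory.klDiv (qθ.prod qω) (B.jointPrior ν ρ) ≠ ⊤ →
        Integrable (fun z : ℝ × (ι → ℝ) => Real.log (B.blockCondLik z.1 z.2)) (qθ.prod qω)) ∧
      B.elbo ν ρ qθ qω ≤ ((Real.log (B.augEvidence ν ρ) : ℝ) : EReal)) ∧
    -- coordinate update of `q(θ)`: the unique maximizer is Gaussian
    (∀ qω : Measure (ι → ℝ), IsProbabilityMeasure qω →
      InformationTheory.klDiv qω (B.pgLaw 0) ≠ ⊤ →
      (∀ t, Integrable (fun ω : ι → ℝ => ω t) qω) ∧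
      0 < B.gaussPrec ρ (fun t => ∫ ω, ω t ∂qω) ∧
      ∀ qθ : Measure ℝ, IsProbabilityMeasure qθ →
        B.elbo ν ρ qθ qω ≤ B.elbo ν ρ (B.gaussUpdate ν ρ (fun t => ∫ ω, ω t ∂qω)) qω ∧
        (B.elbo ν ρ qθ qω = B.elbo ν ρ (B.gaussUpdate ν ρ (fun t => ∫ ω, ω t ∂qω)) qω →
          qθ = B.gaussUpdate ν ρ (fun t => ∫ ω, ω t ∂qω))) ∧
    -- coordinate update of `q(ω)`: the unique maximizer is a product of Pólya–Gamma laws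
    (∀ qθ : Measure ℝ, IsProbabilityMeasure qθ →
      InformationTheory.klDiv qθ (gaussianReal ν (ρ ^ 2)) ≠ ⊤ →
      Integrable (fun θ => θ ^ 2) qθ ∧
      IsProbabilityMeasure (B.pgUpdate (∫ θ, θ ^ 2 ∂qθ)) ∧
      ∀ qω : Measure (ι → ℝ), IsProbabilityMeasure qω →
        B.elbo ν ρ qθ qω ≤ B.elbo ν ρ qθ (B.pgUpdate (∫ θ, θ ^ 2 ∂qθ)) ∧
        (B.elbo ν ρ qθ qω = B.elbo ν ρ qθ (B.pgUpdate (∫ θ, θ ^ 2 ∂qθ)) →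
          qω = B.pgUpdate (∫ θ, θ ^ 2 ∂qθ))) ∧
    -- the moments that the updates use, and the value of the bound, in closed form
    (∀ (μ : ℝ) (s : ℝ≥0), ∫ θ, θ ^ 2 ∂(gaussianReal μ s) = μ ^ 2 + s) ∧
    (∀ (c : ι → ℝ) t, Integrable (fun ω : ι → ℝ => ω t) (B.pgLaw c) ∧
      ∫ ω, ω t ∂(B.pgLaw c) = PolyaGamma.pgMean (B.m t) (c t)) ∧
    (∀ (μ : ℝ) (s : ℝ≥0) (c : ι → ℝ), 0 < s →
      B.elbo ν ρ (gaussianReal μ s) (B.pgLaw c) =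
        ((B.logConst + μ * ∑ t, B.w t * B.kappa t
          - (μ ^ 2 + s) / 2 * ∑ t, B.w t * PolyaGamma.pgMean (B.m t) (c t)
          - (Real.log ((ρ : ℝ) ^ 2 / s) + (s + (μ - ν) ^ 2) / (ρ : ℝ) ^ 2 - 1) / 2
          - ∑ t, (B.m t * Real.log (Real.cosh (c t / 2))
              - c t ^ 2 / 2 * PolyaGamma.pgMean (B.m t) (c t)) : ℝ) : EReal)) := by
  refine ⟨fun t θ hw hh => B.lik_eq_binomial t θ hw hh,
    fun t => ⟨PolyaGamma.isProbabilityMeasure_pgMeasure (B.natCast_m_pos t) 0,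
      PolyaGamma.pgMeasure_eq_withDensity (B.natCast_m_pos t) 0⟩,
    fun t θ => ⟨B.integrable_polyaGamma t θ, B.polyaGamma_identity t θ⟩,
    fun θ ω => ⟨B.blockCondLik_pos θ ω, B.log_blockCondLik θ ω⟩,
    fun ω hω => B.condPosterior_eq ν hρ hω,
    B.augEvidence_pos ν ρ, B.augEvidence_eq_evidence ν ρ, B.augEvidence_le_evidence ν ρ,
    fun qθ qω _ _ => ⟨B.integrable_log_blockCondLik_of_klDiv_ne_top hρ,
      B.elbo_le_log_augEvidence hρ⟩,
    fun qω _ h => ⟨B.integrable_eval_of_klDiv_ne_top h,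
      B.gaussPrec_pos hρ (B.integral_eval_nonneg_of_klDiv_ne_top h),
      fun qθ _ => B.elbo_le_gaussUpdate hρ h⟩,
    fun qθ _ h => ⟨LogisticBlock.integrable_sq_of_klDiv_ne_top hρ h,
      B.isProbabilityMeasure_pgLaw _, fun qω _ => B.elbo_le_pgUpdate hρ h⟩,
    integral_sq_gaussianReal,
    fun c t => ⟨B.integrable_eval_pgLaw c t, B.integral_eval_pgLaw c t⟩,
    fun μ s c hs => B.elbo_gaussianReal_pgLaw ν hρ μ hs c⟩
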